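/- Let $d\ge 2$ and let $p=(p_1,\dots,p_d)$, $p_i\in\mathbb{C}[x_1,\dots,x_d]$, be a zero-dimensional polynomial system (finitely many common zeros in $\mathbb{C}^d$) all of whose roots are simple (the Jacobian matrix $J(\mathbf{x})=(\partial p_i/\partial x_j(\mathbf{x}))_{i,j}$ is invertible at every root) and which has no roots at infinity (the top-degree homogeneous parts of $p_1,\dots,p_d$ have no common zero except the origin). Put $I=\langle p_1,\dots,p_d\rangle$ and $\rho=\sum_i\deg p_i-d+1$. For $\alpha,\beta\in\mathbb{C}^{d+1}$ write $h_\alpha=\alpha_0+\sum_i\alpha_i x_i$, $h_\beta=\beta_0+\sum_i\beta_i x_i$ and $h(\lambda)=h_\alpha-\lambda h_\beta$. The Macaulay matrix of $p_1,\dots,p_d,h(\lambda)$ has one column for every monomial of degree at most $\rho$, and its rows are the coefficient vectors of the products $x^m p_i$ with $\deg x^m\le\rho-\deg p_i$ and $x^m h(\lambda)$ with $\deg x^m\le\rho-1$. A Macaulay resultant eigenproblem for $p$ and $(\alpha,\beta)$ is a square submatrix $M(\lambda)=A-\lambda B$, containing all columns, in which the only omitted rows are rows $x^m h(\lambda)$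 and rows $x^m p_i$ that are linear combinations of the retained rows of the form $x^{m'}p_j$, and such that $\det(A-\lambda B)$ is not identically zero in $\lambda$. (So the rows of $B$ belonging to the $p_i$ are zero, and the others are the coefficient vectors of the polynomials $x^m h_\beta$.) Let $\mathcal{B}$ be the set of the monomials $x^m$ for which the row $x^m h(\lambda)$ is retained. Call $(\alpha,\beta)$ generic for $p$ if $h_\beta$ vanishes at no root of $p$ and the ratios $h_\alpha(\mathbf{x})/h_\beta(\mathbf{x})$ at distinct roots $\mathbf{x}$ of $p$ are distinct. For matrices $A,B\in\mathbb{C}^{n\times n}$ and $\lambda^*\in\mathbb{C}$ let the normwise absolute condition number be $$\kappa_{\mathrm{eig}}(\lambda^*)=\lim_{\delta\to0}\ \limsup_{\epsilon\to0^+}\ \sup\Big\{\tfrac{|\Delta\lambda|}{\epsilon} : |\Delta\lambda|\le\delta,\ \big((A+\Delta A)-(\lambda^*+\Delta\lambda)(B+\Delta B)\big)\mathbf{y}=0 \text{ for some } \mathbf{y}\ne0,\ \|\Delta A\|_2,\|\Delta B\|_2\le\epsilon\Big\}\in[0,\infty].$$ Then almost every $(\alpha,\beta)\in\mathbb{C}^{d+1}\times\mathbb{C}^{d+1}$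 (with respect to Lebesgue measure) is generic for $p$, and for every generic $(\alpha,\beta)$ and every Macaulay resultant eigenproblem $A-\lambda B$ for $p$ and $(\alpha,\beta)$ the following holds. The monomials in $\mathcal{B}$ represent a basis of the vector space $\mathbb{C}[x_1,\dots,x_d]/I$. If $\mathbf{x}^*$ is a root of $p$, $Q\in\mathbb{C}[x_1,\dots,x_d]^{d\times d}$ is any matrix with $p=Q\,(\mathbf{x}-\mathbf{x}^*)$, and $\lambda^*$ is the eigenvalue corresponding to $\mathbf{x}^*$, that is, $h(\lambda^*)(\mathbf{x}^*)=h_\alpha(\mathbf{x}^*)-\lambda^*h_\beta(\mathbf{x}^*)=0$, then the condition number of $\lambda^*$ for the pencil $A-\lambda B$ satisfies $$\kappa_{\mathrm{eig}}(\lambda^*)\ \ge\ \frac{\|[\det Q]_{\mathcal{B}}\|_2\,\|V(\mathbf{x}^*)\|_2}{|\det J(\mathbf{x}^*)\,h_\beta(\mathbf{x}^*)|},$$ where $[\det Q]_{\mathcal{B}}$ is the coordinate vector of the class of $\det Q$ in the basis $\mathcal{B}$ and $V(\mathbf{x}^*)$ is the vector of all monomials of degree at most $\rho$ evaluated at $\mathbf{x}^*$.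 -/

import Mathlib

open MvPolynomial Filter Topology
open scoped ENNReal

noncomputable section

namespace Macaulay

/-- Complex polynomials in `d` variables. -/
abbrev Poly (d : ℕ) : Type := MvPolynomial (Fin d) ℂ

/-! ### Polynomial systems -/

/-- `x` is a common zero of `p₁, …, p_d`. -/
def IsSystemRoot {d : ℕ} (p : Fin d → Poly d) (x : Fin d → ℂ) : Prop :=
  ∀ i, eval x (p i) = 0

/-- The Jacobian matrix of the system at `x`. -/
def jacobian {d : ℕ} (p : Fin d → Poly d) (x : Fin d → ℂ) : Matrix (Fin d) (Fin d) ℂ :=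
  Matrix.of fun i j => eval x (pderiv j (p i))

/-- No roots at infinity: the top-degree homogeneous parts of the `pᵢ` have no common zero other
than the origin. -/
def NoRootsAtInfinity {d : ℕ} (p : Fin d → Poly d) : Prop :=
  ∀ x : Fin d → ℂ,
    (∀ i, eval x (homogeneousComponent (p i).totalDegree (p i)) = 0) → x = 0

/-- The ideal `⟨p₁, …, p_d⟩`. -/
abbrev systemIdeal {d : ℕ} (p : Fin d → Poly d) : Ideal (Poly d) :=
  Ideal.span (Set.range p)

/-! ### The Macaulay matrix -/

/-- The affine-linear polynomial `a₀ + a₁ x₁ + ⋯ + a_d x_d`. -/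
def linPoly {d : ℕ} (a : Fin (d + 1) → ℂ) : Poly d :=
  C (a 0) + ∑ i : Fin d, C (a i.succ) * X i

/-- `ρ = ∑ deg pᵢ - d + 1`. -/
def rho {d : ℕ} (p : Fin d → Poly d) : ℕ :=
  (∑ i, (p i).totalDegree) + 1 - d

/-- Column labels: (exponents of) the monomials of degree at most `ρ`. -/
abbrev Col {d : ℕ} (p : Fin d → Poly d) : Type :=
  {m : Fin d →₀ ℕ // m.degree ≤ rho p}

instance instFintypeCol {d : ℕ} (p : Fin d → Poly d) : Fintype (Col p) :=
  Set.Finite.fintype (Finsupp.finite_of_degree_le (rho p))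

/-- Labels `(i, m)` of the rows `x^m pᵢ`, with `deg x^m ≤ ρ - deg pᵢ`. -/
abbrev SysRow {d : ℕ} (p : Fin d → Poly d) : Type :=
  {r : Fin d × (Fin d →₀ ℕ) // r.2.degree + (p r.1).totalDegree ≤ rho p}

/-- Labels `m` of the rows `x^m h`, with `deg x^m ≤ ρ - 1`. -/
abbrev LinRow {d : ℕ} (p : Fin d → Poly d) : Type :=
  {m : Fin d →₀ ℕ // m.degree + 1 ≤ rho p}

/-- The polynomial `x^m pᵢ` of a system row. -/
def sysRowPoly {d : ℕ} (p : Fin d → Poly d) (r : SysRow p) : Poly d :=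
  monomial r.1.2 1 * p r.1.1

/-- The full (rectangular) Macaulay matrix of `p₁, …, p_d, h` with
`h = a₀ + a₁ x₁ + ⋯ + a_d x_d`: each row holds the coefficients of its polynomial. -/
def macaulayMatrix {d : ℕ} (p : Fin d → Poly d) (a : Fin (d + 1) → ℂ) :
    Matrix (SysRow p ⊕ LinRow p) (Col p) ℂ :=
  Matrix.of fun r c =>
    match r with
    | Sum.inl s => coeff c.1 (sysRowPoly p s)
    | Sum.inr m => coeff c.1 (monomial m.1 1 * linPoly a)

/-- The matrix with zero system rows and `h`-rows built from `b₀ + b₁ x₁ + ⋯ + b_d x_d`. -/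
def macaulayMatrixLin {d : ℕ} (p : Fin d → Poly d) (b : Fin (d + 1) → ℂ) :
    Matrix (SysRow p ⊕ LinRow p) (Col p) ℂ :=
  Matrix.of fun r c =>
    match r with
    | Sum.inl _ => 0
    | Sum.inr m => coeff c.1 (monomial m.1 1 * linPoly b)

/-- The square matrix `A` of the pencil `A - λ B` obtained from
`h = ∑ (αᵢ - λ βᵢ) xᵢ` (with `x₀ = 1`) by retaining the rows listed by `sel`. -/
def matA {d : ℕ} (p : Fin d → Poly d) (α : Fin (d + 1) → ℂ)
    (sel : Col p ↪ SysRow p ⊕ LinRow p) : Matrix (Col p) (Col p) ℂ :=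
  (macaulayMatrix p α).submatrix sel id

/-- The square matrix `B` of the pencil `A - λ B`. -/
def matB {d : ℕ} (p : Fin d → Poly d) (β : Fin (d + 1) → ℂ)
    (sel : Col p ↪ SysRow p ⊕ LinRow p) : Matrix (Col p) (Col p) ℂ :=
  (macaulayMatrixLin p β).submatrix sel id

/-- `sel` (a list of pairwise different rows of the Macaulay matrix, as many as there are columns)
defines a Macaulay resultant eigenproblem: no row `x^m pᵢ` has been dropped, apart from rows that
are linear combinations of the retained rows of this kind, and the pencil `A - λ B` is regular. -/
structure IsMacaulayEigenproblem {d : ℕ} (p : Fin d → Poly d) (α β : Fin (d + 1) → ℂ)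
    (sel : Col p ↪ SysRow p ⊕ LinRow p) : Prop where
  system_rows : ∀ r : SysRow p, sysRowPoly p r ∈
    Submodule.span ℂ (sysRowPoly p '' {s : SysRow p | Sum.inl s ∈ Set.range sel})
  regular : ∃ μ : ℂ, (matA p α sel - μ • matB p β sel).det ≠ 0

/-- The retained `h`-rows; they are labelled by monomials. -/
abbrev RetainedLinRow {d : ℕ} {p : Fin d → Poly d}
    (sel : Col p ↪ SysRow p ⊕ LinRow p) : Type :=
  {m : LinRow p // Sum.inr m ∈ Set.range sel}

/-- The genericity of the random coefficients: `β` vanishes at no root of `p`, and the ratios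
`α(x) / β(x)` at different roots are different. -/
def IsGenericPair {d : ℕ} (p : Fin d → Poly d) (α β : Fin (d + 1) → ℂ) : Prop :=
  (∀ x, IsSystemRoot p x → eval x (linPoly β) ≠ 0) ∧
  ∀ x y, IsSystemRoot p x → IsSystemRoot p y → x ≠ y →
    eval x (linPoly α) * eval y (linPoly β) ≠ eval y (linPoly α) * eval x (linPoly β)

/-- The vector `V(x)` of the column labels evaluated at `x`. -/
def colLabels {d : ℕ} (p : Fin d → Poly d) (x : Fin d → ℂ) : EuclideanSpace ℂ (Col p) :=
  WithLp.toLp 2 fun c => ∏ i, x i ^ c.1 i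

/-- The Euclidean norm of the coordinate vector `[f]_b` of `f` in the basis `b`. -/
def coordNorm {ι W : Type*} [AddCommGroup W] [Module ℂ W] (b : Module.Basis ι ℂ W) (f : W) : ℝ :=
  Real.sqrt ((b.repr f).sum fun _ c => ‖c‖ ^ 2)

/-! ### The condition number of an eigenvalue -/

/-- The spectral norm. -/
def spectralNorm {n : Type*} [Fintype n] [DecidableEq n] (M : Matrix n n ℂ) : ℝ :=
  ‖Matrix.toEuclideanCLM (n := n) (𝕜 := ℂ) M‖

/-- `lam + Δ` is an eigenvalue of some pencil `(A + ΔA) - z (B + ΔB)` with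
`‖ΔA‖₂ ≤ ε` and `‖ΔB‖₂ ≤ ε`. -/
def IsEigenvalueShift {n : Type*} [Fintype n] [DecidableEq n] (A B : Matrix n n ℂ) (lam : ℂ)
    (ε : ℝ) (Δ : ℂ) : Prop :=
  ∃ ΔA ΔB : Matrix n n ℂ, spectralNorm ΔA ≤ ε ∧ spectralNorm ΔB ≤ ε ∧
    ∃ y : n → ℂ, y ≠ 0 ∧ ((A + ΔA) - (lam + Δ) • (B + ΔB)).mulVec y = 0

/-- The normwise absolute condition number of the eigenvalue `lam` of `A - z B`, that is
`limsup_{ε → 0} sup |Δ| / ε`, the supremum taken over the shifts `Δ` of `lam` produced by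
perturbations of `A` and `B` of norm at most `ε`. Only eigenvalues close to `lam` count as shifted
copies of `lam` (`|Δ| ≤ δ`, where `δ → 0` after `ε → 0`). -/
def eigCond {n : Type*} [Fintype n] [DecidableEq n] (A B : Matrix n n ℂ) (lam : ℂ) : ℝ≥0∞ :=
  ⨅ (δ : ℝ) (_ : 0 < δ),
    limsup (fun ε : ℝ => ⨆ (Δ : ℂ) (_ : IsEigenvalueShift A B lam ε Δ ∧ ‖Δ‖ ≤ δ),
      ENNReal.ofReal (‖Δ‖ / ε)) (𝓝[>] (0 : ℝ))

end Macaulay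

end

noncomputable section

namespace Macaulay

/-! ### Graded pieces with shifted degrees -/

/-! The bound comes from explicit eigenvectors. A combination of the rows of the pencil is a
polynomial `s + r * h(μ)`, where `s` combines system rows and `r` lies in the span of the retained
monomials, so left null vectors are polynomial identities. The right eigenvector at a root is
`V(x*)`. For the left one, Cramer's rule applied to `p = Q (x - x*)` puts `det Q * f` in `I`
whenever `f(x*) = 0`, in particular for `f = h(λ*)`. If `r` represents `det Q` in the retained
monomials, then `r * h(λ*)` lies in `I` and has degree at most `ρ`; cancelling it by system rows
gives a left null vector `w` whose `h`-entries are `[det Q]_B`. Since `det Q` takes the value `det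
J(x*)` at `x*`, `wᵀ B V = det J(x*) h_β(x*)`. A rank-one perturbation then gives condition at least
`‖w‖ ‖V‖ / |wᵀ B V|`, and `‖w‖` is at least the norm of its `h`-entries.

Two algebraic facts support this. First, without roots at infinity every element of `I` of degree at
most `ρ` is a combination of system rows (`NoRootsAtInfinity.mem_span_sysRowPoly`). The leading
forms have only Koszul syzygies (`OnlyZero.koszulExact`), and these lift to the `pᵢ`, so a
representation with too high degrees can be lowered. Second, with simple roots `I` consists of all
polynomials vanishing at the roots, and the `det Q` of the various roots are interpolation
polynomials of degree at most `ρ`.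

With regularity of the pencil, these facts show that the retained monomials form a basis and, for
generic coefficients, that left eigenspaces are lines. Genericity fails only on a finite union of
null sets. -/

/-- The homogeneous part of degree `n - e`, which is zero if `n < e`. -/
def shiftComp {d : ℕ} (n e : ℕ) : Poly d →ₗ[ℂ] Poly d :=
  if e ≤ n then homogeneousComponent (n - e) else 0

lemma homogeneousComponent_mul_of_isHomogeneous {d : ℕ} {g : Poly d} {a : ℕ}
    (hg : g.IsHomogeneous a) (f : Poly d) (n : ℕ) :
    homogeneousComponent n (f * g) = shiftComp n a f * g := by
  have key : ∀ i, homogeneousComponent n (homogeneousComponent i f * g) =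
      if i + a = n then homogeneousComponent i f * g else 0 := fun i => by
    have h : (homogeneousComponent i f * g).IsHomogeneous (i + a) :=
      (homogeneousComponent_isHomogeneous i f).mul hg
    rw [homogeneousComponent_of_mem ((mem_homogeneousSubmodule _ _).2 h)]
    simp [eq_comm]
  conv_lhs => rw [← sum_homogeneousComponent f, Finset.sum_mul, map_sum]
  simp_rw [key]
  unfold shiftComp
  split_ifs with h
  · rw [Finset.sum_eq_single (n - a)]
    · rw [if_pos (by omega)]
    · intro b _ hb
      rw [if_neg (by omega)]
    · intro hb
      rw [homogeneousComponent_eq_zero _ _ (by simp at hb; omega)]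
      simp
  · rw [LinearMap.zero_apply, zero_mul]
    exact Finset.sum_eq_zero fun i _ => if_neg (by omega)

lemma shiftComp_mul {d : ℕ} {g : Poly d} {a : ℕ} (hg : g.IsHomogeneous a) (f : Poly d)
    (n e : ℕ) : shiftComp n e (f * g) = shiftComp n (e + a) f * g := by
  by_cases h : e ≤ n
  · have h1 : shiftComp n e (f * g) = homogeneousComponent (n - e) (f * g) := by
      simp [shiftComp, h]
    rw [h1, homogeneousComponent_mul_of_isHomogeneous hg]
    by_cases h2 : e + a ≤ n
    · simp [shiftComp, h2, show a ≤ n - e by omega, Nat.sub_sub]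
    · simp [shiftComp, h2, show ¬ a ≤ n - e by omega]
  · simp [shiftComp, h, show ¬ e + a ≤ n by omega]

lemma shiftComp_zero_right {d : ℕ} (n : ℕ) (f : Poly d) :
    shiftComp n 0 f = homogeneousComponent n f := by simp [shiftComp]

lemma shiftComp_shiftComp {d : ℕ} (n e : ℕ) (f : Poly d) :
    shiftComp n e (shiftComp n e f) = shiftComp n e f := by
  unfold shiftComp
  split_ifs with h
  · exact homogeneousComponent_eq_self
      ((mem_homogeneousSubmodule _ _).2 (homogeneousComponent_isHomogeneous _ _))
  · rfl

lemma shiftComp_add_eq {d : ℕ} {n a : ℕ} (h : a ≤ n) (e : ℕ) (f : Poly d) :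
    shiftComp n (e + a) f = shiftComp (n - a) e f := by
  unfold shiftComp
  by_cases h2 : e + a ≤ n
  · rw [if_pos h2, if_pos (by omega)]
    congr 2
    omega
  · rw [if_neg h2, if_neg (by omega)]

lemma shiftComp_eq_zero {d : ℕ} {n e : ℕ} (h : n < e) (f : Poly d) : shiftComp n e f = 0 := by
  simp [shiftComp, show ¬ e ≤ n by omega]

lemma sum_shiftComp {d : ℕ} (e : ℕ) (f : Poly d) {N : ℕ} (hN : e + f.totalDegree < N) :
    ∑ n ∈ Finset.range N, shiftComp n e f = f := by
  conv_rhs => rw [← sum_homogeneousComponent f]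
  rw [← Finset.sum_range_add_sum_Ico _ (show e ≤ N by omega), Finset.sum_eq_zero, zero_add,
    Finset.sum_Ico_eq_sum_range]
  · rw [← Finset.sum_range_add_sum_Ico _ (show f.totalDegree + 1 ≤ N - e by omega)]
    rw [Finset.sum_eq_zero (s := Finset.Ico _ _), add_zero]
    · exact Finset.sum_congr rfl fun i _ => by simp [shiftComp]
    · intro i hi
      have := Finset.mem_Ico.1 hi
      simp only [shiftComp, le_add_iff_nonneg_right, zero_le, if_true, add_tsub_cancel_left]
      exact homogeneousComponent_eq_zero _ _ (by omega)
  · intro i hi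
    exact shiftComp_eq_zero (Finset.mem_range.1 hi) f

/-- Graded parts of a syzygy are syzygies. -/
lemma sum_shiftComp_mul {d : ℕ} {ι : Type*} [Fintype ι] {g : ι → Poly d} {e : ι → ℕ}
    (hg : ∀ i, (g i).IsHomogeneous (e i)) (q : ι → Poly d) (n : ℕ) :
    ∑ i, shiftComp n (e i) (q i) * g i = homogeneousComponent n (∑ i, q i * g i) := by
  rw [map_sum]
  exact Finset.sum_congr rfl fun i _ => (homogeneousComponent_mul_of_isHomogeneous (hg i) _ _).symm

/-! ### Syzygies of systems of homogeneous polynomials -/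

/-- Every syzygy of `g` is a combination of the trivial ones `gᵢ gⱼ - gⱼ gᵢ = 0`. -/
def KoszulExact {R ι : Type*} [CommRing R] [Fintype ι] (g : ι → R) : Prop :=
  ∀ q : ι → R, ∑ i, q i * g i = 0 →
    ∃ A : ι → ι → R, (∀ i, A i i = 0) ∧ (∀ i j, A i j = - A j i) ∧ ∀ i, q i = ∑ j, A i j * g j

/-- A graded syzygy of a Koszul exact homogeneous system is a graded combination of the trivial
ones. -/
lemma KoszulExact.graded {d : ℕ} {ι : Type*} [Fintype ι] {g : ι → Poly d} {e : ι → ℕ}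
    (hg : ∀ i, (g i).IsHomogeneous (e i)) (hK : KoszulExact g) {q : ι → Poly d} {n : ℕ}
    (hq : ∀ i, shiftComp n (e i) (q i) = q i) (hs : ∑ i, q i * g i = 0) :
    ∃ A : ι → ι → Poly d, (∀ i, A i i = 0) ∧ (∀ i j, A i j = - A j i) ∧
      (∀ i j, shiftComp n (e i + e j) (A i j) = A i j) ∧ ∀ i, q i = ∑ j, A i j * g j := by
  obtain ⟨A, h0, h1, h2⟩ := hK q hs
  refine ⟨fun i j => shiftComp n (e i + e j) (A i j), fun i => by simp [h0], fun i j => ?_,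
    fun i j => shiftComp_shiftComp _ _ _, fun i => ?_⟩
  · simp only
    rw [h1 i j, map_neg, add_comm]
  · conv_lhs => rw [← hq i, h2 i, map_sum]
    exact Finset.sum_congr rfl fun j _ => shiftComp_mul (hg j) _ _ _

/-- Koszul exactness may be tested on graded syzygies. -/
lemma exists_koszul_of_graded {d : ℕ} {ι : Type*} [Fintype ι] {g : ι → Poly d} {e : ι → ℕ}
    (hg : ∀ i, (g i).IsHomogeneous (e i)) (p : (ι → ι → Poly d) → Prop)
    (hp : ∀ (s : Finset ℕ) (A : ℕ → ι → ι → Poly d), (∀ n, p (A n)) →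
      p (fun i j => ∑ n ∈ s, A n i j)) (r : ι → Prop)
    (h : ∀ n (q : ι → Poly d), (∀ i, shiftComp n (e i) (q i) = q i) → ∑ i, q i * g i = 0 →
      (∀ i, r i → q i = 0) → ∃ A : ι → ι → Poly d, p A ∧ ∀ i, q i = ∑ j, A i j * g j)
    (q : ι → Poly d) (hs : ∑ i, q i * g i = 0) (hr : ∀ i, r i → q i = 0) :
    ∃ A : ι → ι → Poly d, p A ∧ ∀ i, q i = ∑ j, A i j * g j := by
  have := fun n => h n (fun i => shiftComp n (e i) (q i)) (fun i => shiftComp_shiftComp _ _ _)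
    (by rw [sum_shiftComp_mul hg, hs, map_zero]) (fun i hi => by simp [hr i hi])
  choose A hA hA' using this
  -- `N` exceeds every degree at which some `q i * g i` can be nonzero, so the graded pieces below
  -- `N` recover all `q i`.
  set N := (∑ i, (e i + (q i).totalDegree)) + 1
  refine ⟨fun i j => ∑ n ∈ Finset.range N, A n i j, hp _ _ hA, fun i => ?_⟩
  have hN : e i + (q i).totalDegree < N := Nat.lt_succ_of_le
    (Finset.single_le_sum (f := fun i => e i + (q i).totalDegree) (fun _ _ => Nat.zero_le _)
      (Finset.mem_univ i))
  conv_lhs => rw [← sum_shiftComp (e i) (q i) hN]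
  simp_rw [Finset.sum_mul]
  rw [Finset.sum_comm]
  exact Finset.sum_congr rfl fun n _ => hA' n i

lemma skew_sum {R ι : Type*} [CommRing R] (s : Finset ℕ) (A : ℕ → ι → ι → R)
    (h : ∀ n, (∀ i, A n i i = 0) ∧ ∀ i j, A n i j = - A n j i) :
    (∀ i, ∑ n ∈ s, A n i i = 0) ∧ ∀ i j, ∑ n ∈ s, A n i j = - ∑ n ∈ s, A n j i :=
  ⟨fun i => Finset.sum_eq_zero fun n _ => (h n).1 i, fun i j => by
    rw [← Finset.sum_neg_distrib]
    exact Finset.sum_congr rfl fun n _ => (h n).2 i j⟩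

/-- Euler's identity supplies the matrix. For forms `q i` of degree `n - 1`, applying `∂ᵢ` to `∑ qⱼ
xⱼ = 0` gives `qᵢ = -∑ xⱼ ∂ᵢ qⱼ`. Adding `(n - 1) qᵢ = ∑ xⱼ ∂ⱼ qᵢ` yields `n qᵢ = ∑ (∂ⱼ qᵢ - ∂ᵢ qⱼ)
xⱼ`, which is skew. -/
lemma koszulExact_X (d : ℕ) : KoszulExact (fun i : Fin d => (X i : Poly d)) := by
  intro q hs
  suffices h : ∀ n (q : Fin d → Poly d), (∀ i, shiftComp n 1 (q i) = q i) →
      ∑ i, q i * X i = 0 → (∀ i : Fin d, False → q i = 0) →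
      ∃ A : Fin d → Fin d → Poly d, ((∀ i, A i i = 0) ∧ ∀ i j, A i j = - A j i) ∧
        ∀ i, q i = ∑ j, A i j * X j by
    obtain ⟨A, hA, h⟩ := exists_koszul_of_graded (e := fun _ => 1) (fun i => isHomogeneous_X ℂ i)
      (fun A => (∀ i, A i i = 0) ∧ ∀ i j, A i j = - A j i) skew_sum (fun _ => False) h q hs
      (fun _ h => h.elim)
    exact ⟨A, hA.1, hA.2, h⟩
  clear q hs
  intro n q hq hs _
  rcases Nat.eq_zero_or_pos n with rfl | hn
  · have : ∀ i, q i = 0 := fun i => by rw [← hq i, shiftComp_eq_zero one_pos]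
    exact ⟨0, by simp, by simp [this]⟩
  have hhom : ∀ i, (q i).IsHomogeneous (n - 1) := fun i => by
    rw [← hq i, shiftComp, if_pos (show 1 ≤ n from hn)]
    exact homogeneousComponent_isHomogeneous _ _
  have hn0 : (n : ℂ) ≠ 0 := by exact_mod_cast hn.ne'
  refine ⟨fun i j => C (n : ℂ)⁻¹ * (pderiv j (q i) - pderiv i (q j)), ⟨by simp, fun i j => by ring⟩,
    fun i => ?_⟩
  have h1 := (hhom i).sum_X_mul_pderiv
  have h2 : ∑ j, pderiv i (q j) * X j + q i = 0 := by
    have := congrArg (pderiv i) hs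
    rw [map_sum, map_zero] at this
    rw [← this]
    simp only [pderiv_mul, Finset.sum_add_distrib]
    congr 1
    simp only [pderiv_X, Pi.single_apply]
    simp
  have h3 : ∑ j, C (n : ℂ)⁻¹ * (pderiv j (q i) - pderiv i (q j)) * X j =
      C (n : ℂ)⁻¹ * (∑ j, X j * pderiv j (q i) - ∑ j, pderiv i (q j) * X j) := by
    rw [← Finset.sum_sub_distrib, Finset.mul_sum]
    exact Finset.sum_congr rfl fun j _ => by ring
  rw [h3, h1, eq_neg_of_add_eq_zero_left h2, sub_neg_eq_add, nsmul_eq_mul]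
  have h4 : ((n - 1 : ℕ) : Poly d) * q i + q i = C (n : ℂ) * q i := by
    rw [← add_one_mul]
    congr 1
    rw [show (C (n : ℂ) : Poly d) = ((n - 1 + 1 : ℕ) : Poly d) by
      rw [Nat.sub_add_cancel hn]; simp]
    push_cast; rfl
  rw [h4, ← mul_assoc, ← C_mul, inv_mul_cancel₀ hn0, C_1, one_mul]

/-- Syzygies that do not involve `gᵢ` are combinations of trivial ones that do not either. -/
lemma KoszulExact.exists_of_apply_eq_zero {d : ℕ} {ι : Type*} [Fintype ι] [DecidableEq ι]
    {g : ι → Poly d} {e : ι → ℕ} (hg : ∀ i, (g i).IsHomogeneous (e i)) (he : ∀ i, 0 < e i)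
    (hK : KoszulExact g) (i : ι) (q : ι → Poly d) (hs : ∑ j, q j * g j = 0) (hi : q i = 0) :
    ∃ A : ι → ι → Poly d, ((∀ j, A j j = 0) ∧ (∀ j k, A j k = - A k j) ∧ ∀ j, A i j = 0) ∧
      ∀ j, q j = ∑ k, A j k * g k := by
  refine exists_koszul_of_graded hg
    (fun A => (∀ j, A j j = 0) ∧ (∀ j k, A j k = - A k j) ∧ ∀ j, A i j = 0) ?_ (fun j => j = i)
    ?_ q hs (fun j hj => hj ▸ hi)
  · intro s A hA
    obtain ⟨h1, h2⟩ := skew_sum s A fun n => ⟨(hA n).1, (hA n).2.1⟩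
    exact ⟨h1, h2, fun j => Finset.sum_eq_zero fun n _ => (hA n).2.2 j⟩
  · intro n
    induction n using Nat.strong_induction_on with
    | _ n ih =>
    intro q hq hs hi
    replace hi := hi i rfl
    obtain ⟨A, h0, h1, h2, h3⟩ := hK.graded hg hq hs
    -- Since `q i = 0`, column `i` of the skew matrix `A` is itself a syzygy with vanishing `i`-th
    -- entry. Its degree is `n - e i < n`, so the induction hypothesis applies.
    have hrow : ∑ j, A j i * g j = 0 := by
      have := h3 i
      rw [hi] at this
      rw [← neg_eq_zero, ← Finset.sum_neg_distrib, this]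
      exact Finset.sum_congr rfl fun j _ => by rw [h1 i j]; ring
    obtain ⟨A', ⟨h0', h1', h2'⟩, h3'⟩ : ∃ A' : ι → ι → Poly d,
        ((∀ j, A' j j = 0) ∧ (∀ j k, A' j k = - A' k j) ∧ ∀ j, A' i j = 0) ∧
          ∀ j, A j i = ∑ k, A' j k * g k := by
      by_cases hn : e i ≤ n
      · refine ih (n - e i) (by have := he i; omega) (fun j => A j i) (fun j => ?_) hrow
          (fun j hj => hj ▸ h0 i)
        rw [← shiftComp_add_eq hn, h2]
      · refine ⟨0, by simp, fun j => ?_⟩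
        rw [← h2 j i, shiftComp_eq_zero (by omega)]
        simp
    -- Row and column `i` of `A` are erased; the lost term `A j i * g i` is recovered by expanding
    -- `A j i` through `A'`, which avoids `i`.
    refine ⟨fun j k => (if j = i ∨ k = i then 0 else A j k) + g i * A' j k, ⟨?_, ?_, ?_⟩, ?_⟩
    · intro j; simp [h0, h0']
    · intro j k
      simp only [or_comm (a := j = i)]
      rw [h1' j k]
      split_ifs
      · ring
      · rw [h1 j k]; ring
    · intro j; simp [h2']
    · intro j
      simp only [add_mul, Finset.sum_add_distrib]
      have e1 : ∑ k, g i * A' j k * g k = g i * A j i := by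
        rw [h3' j, Finset.mul_sum]
        exact Finset.sum_congr rfl fun k _ => by ring
      rw [e1]
      by_cases hj : j = i
      · subst hj; simp [hi, h0]
      · rw [h3 j, ← Finset.sum_erase_add _ _ (Finset.mem_univ i), mul_comm (g i)]
        congr 1
        rw [← Finset.sum_erase_add _ _ (Finset.mem_univ i)]
        simp only [hj, or_true, if_true, zero_mul, add_zero]
        refine Finset.sum_congr rfl fun k hk => ?_
        rw [if_neg]
        simp [Finset.ne_of_mem_erase hk]

/-- Replacing one member of a homogeneous Koszul exact system by a divisor, modulo the other
members, of one of its powers. -/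
lemma KoszulExact.exchange {d : ℕ} {ι : Type*} [Fintype ι] [DecidableEq ι]
    {g : ι → Poly d} {e : ι → ℕ} (hg : ∀ i, (g i).IsHomogeneous (e i)) (he : ∀ i, 0 < e i)
    (hK : KoszulExact g) (i : ι) (f : Poly d) (N : ℕ)
    (hf : g i ^ N ∈ Ideal.span (Set.range (Function.update g i f))) :
    KoszulExact (Function.update g i f) := by
  set c : Ideal (Poly d) := Ideal.span (g '' {j | j ≠ i}) with hc
  have hgc : ∀ j, j ≠ i → g j ∈ c := fun j hj => Ideal.subset_span ⟨j, hj, rfl⟩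
  have mem_c : ∀ b ∈ c, ∃ r : ι → Poly d, r i = 0 ∧ b = ∑ j, r j * g j := by
    intro b hb
    induction hb using Submodule.span_induction with
    | mem x hx =>
      obtain ⟨j, hj, rfl⟩ := hx
      exact ⟨Pi.single j 1, by simp [Ne.symm hj], by simp [Pi.single_apply]⟩
    | zero => exact ⟨0, by simp, by simp⟩
    | add x y _ _ hx hy =>
      obtain ⟨r, h1, rfl⟩ := hx
      obtain ⟨s, h2, rfl⟩ := hy
      exact ⟨r + s, by simp [h1, h2], by simp [add_mul, Finset.sum_add_distrib]⟩
    | smul a x _ hx =>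
      obtain ⟨r, h1, rfl⟩ := hx
      exact ⟨fun j => a * r j, by simp [h1], by simp [Finset.mul_sum, mul_assoc]⟩
  -- Koszul exactness makes `g i` a nonzerodivisor modulo the other members: a relation `b * g i ∈
  -- c` is a syzygy with `i`-th entry `b`, and `A i i = 0` then puts `b` in `c`.
  have reg : ∀ b, b * g i ∈ c → b ∈ c := by
    intro b hb
    obtain ⟨r, hr, hb⟩ := mem_c _ hb
    obtain ⟨A, h0, h1, h2⟩ := hK (fun j => if j = i then b else - r j) (by
      rw [← Finset.sum_erase_add _ _ (Finset.mem_univ i)]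
      rw [← Finset.sum_erase_add _ _ (Finset.mem_univ i), hr, zero_mul, add_zero] at hb
      rw [if_pos rfl, hb, ← Finset.sum_add_distrib]
      exact Finset.sum_eq_zero fun j hj => by rw [if_neg (Finset.ne_of_mem_erase hj)]; ring)
    have := h2 i
    rw [if_pos rfl] at this
    rw [this]
    refine Ideal.sum_mem _ fun j _ => ?_
    by_cases hj : j = i
    · subst hj; simp [h0]
    · exact Ideal.mul_mem_left _ _ (hgc j hj)
  have regN : ∀ k b, b * g i ^ k ∈ c → b ∈ c := by
    intro k
    induction k with
    | zero => intro b hb; simpa using hb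
    | succ k ih => exact fun b hb => ih b (reg _ (by rwa [mul_assoc, ← pow_succ]))
  obtain ⟨u, hu⟩ : ∃ u, g i ^ N - u * f ∈ c := by
    have hle : Ideal.span (Set.range (Function.update g i f)) ≤ c ⊔ Ideal.span {f} := by
      rw [Ideal.span_le]
      rintro _ ⟨j, rfl⟩
      by_cases hj : j = i
      · subst hj
        rw [Function.update_self]
        exact Ideal.mem_sup_right (Ideal.subset_span rfl)
      · rw [Function.update_of_ne hj]
        exact Ideal.mem_sup_left (hgc j hj)
    obtain ⟨a, ha, b, hb, hab⟩ := Submodule.mem_sup.1 (hle hf)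
    obtain ⟨u, rfl⟩ := Ideal.mem_span_singleton'.1 hb
    exact ⟨u, by rw [← hab]; simpa using ha⟩
  have upd : ∀ a : ι → Poly d, ∑ j, a j * Function.update g i f j =
      a i * f + ∑ j ∈ Finset.univ.erase i, a j * g j := by
    intro a
    rw [← Finset.add_sum_erase _ _ (Finset.mem_univ i), Function.update_self]
    congr 1
    exact Finset.sum_congr rfl fun j hj => by
      rw [Function.update_of_ne (Finset.ne_of_mem_erase hj)]
  intro q hs
  rw [upd] at hs
  -- Modulo `c`, `f` divides a power of the nonzerodivisor `g i`, so it is a nonzerodivisor too.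
  have hqi : q i ∈ c := by
    apply regN N
    have h1 : q i * f ∈ c := by
      rw [eq_neg_of_add_eq_zero_left hs]
      exact neg_mem (Ideal.sum_mem _ fun j hj =>
        Ideal.mul_mem_left _ _ (hgc j (Finset.ne_of_mem_erase hj)))
    have : q i * g i ^ N = q i * (g i ^ N - u * f) + u * (q i * f) := by ring
    rw [this]
    exact add_mem (Ideal.mul_mem_left _ _ hu) (Ideal.mul_mem_left _ _ h1)
  obtain ⟨r, hri, hr⟩ := mem_c _ hqi
  have hr' : q i = ∑ j ∈ Finset.univ.erase i, r j * g j := by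
    rw [hr, ← Finset.add_sum_erase _ _ (Finset.mem_univ i), hri, zero_mul, zero_add]
  -- Subtracting the trivial syzygies between `f` and the `g j` with coefficients `r j` kills the
  -- `i`-th entry. The remainder is a syzygy of the other members alone.
  obtain ⟨A, ⟨h0, h1, h2⟩, h3⟩ := hK.exists_of_apply_eq_zero hg he i
    (fun j => if j = i then 0 else q j + r j * f) (by
      rw [← Finset.add_sum_erase _ _ (Finset.mem_univ i), if_pos rfl, zero_mul, zero_add, ← hs, hr',
        Finset.sum_mul, ← Finset.sum_add_distrib]
      exact Finset.sum_congr rfl fun j hj => by rw [if_neg (Finset.ne_of_mem_erase hj)]; ring)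
    (if_pos rfl)
  refine ⟨fun j k => A j k + if j = i then r k else if k = i then - r j else 0, ?_, ?_, ?_⟩
  · intro j; by_cases hj : j = i
    · subst hj; simp [h0, hri]
    · simp [h0, hj]
  · intro j k
    simp only
    rw [h1 j k]
    by_cases hj : j = i <;> by_cases hk : k = i
    · subst hj; subst hk; simp [hri]
    · subst hj; simp [hk]; ring
    · subst hk; simp [hj]; ring
    · simp [hj, hk]
  · intro j
    rw [upd]
    by_cases hj : j = i
    · subst hj
      simp [h2, hri, hr']
    · have := h3 j
      simp only [hj, if_false] at this ⊢
      rw [← Finset.add_sum_erase _ _ (Finset.mem_univ i), h1 j i, h2] at this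
      simp only [if_true, h1 j i, h2]
      have e2 : ∑ k ∈ Finset.univ.erase i, (A j k + if k = i then - r j else 0) * g k =
          ∑ k ∈ Finset.univ.erase i, A j k * g k :=
        Finset.sum_congr rfl fun k hk => by rw [if_neg (Finset.ne_of_mem_erase hk), add_zero]
      rw [e2]
      linear_combination this

/-! ### Forms whose only common zero is the origin -/

/-- The polynomials `gᵢ` have no common zero except possibly the origin. -/
def OnlyZero {d : ℕ} {ι : Type*} (g : ι → Poly d) : Prop :=
  ∀ x : Fin d → ℂ, (∀ i, eval x (g i) = 0) → x = 0

lemma OnlyZero.exists_pow_mem {d : ℕ} {ι : Type*} {g : ι → Poly d} (hg : OnlyZero g) {f : Poly d}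
    (hf : eval 0 f = 0) : ∃ N, f ^ N ∈ Ideal.span (Set.range g) := by
  have : f ∈ vanishingIdeal ℂ (zeroLocus ℂ (Ideal.span (Set.range g))) := by
    intro x hx
    rw [zeroLocus_span] at hx
    have h0 : x = 0 := hg x fun i => by
      have := hx (g i) ⟨i, rfl⟩
      simpa using this
    rw [h0]
    simpa using hf
  rwa [vanishingIdeal_zeroLocus_eq_radical] at this

/-- By the Nullstellensatz the ideal contains some `X j ^ N j` for each `j`; a monomial of degree
above `∑ N j` is divisible by one of them. -/
lemma OnlyZero.exists_isHomogeneous_mem {d : ℕ} {ι : Type*} {g : ι → Poly d} (hg : OnlyZero g) :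
    ∃ E, ∀ n, E < n → ∀ f : Poly d, f.IsHomogeneous n → f ∈ Ideal.span (Set.range g) := by
  choose N hN using fun j : Fin d => hg.exists_pow_mem (f := X j) (by simp)
  refine ⟨∑ j, N j, fun n hn f hf => ?_⟩
  rw [f.as_sum]
  refine Ideal.sum_mem _ fun m hm => ?_
  have hdeg : m.degree = n := by
    by_contra h
    exact (mem_support_iff.1 hm) (hf.coeff_eq_zero h)
  obtain ⟨j, hj⟩ : ∃ j, N j ≤ m j := by
    by_contra! h
    have : m.degree ≤ ∑ j, N j := by
      rw [Finsupp.degree_eq_sum]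
      exact Finset.sum_le_sum fun j _ => (h j).le
    omega
  have : monomial m (coeff m f) = monomial (m - Finsupp.single j (N j)) (coeff m f) * X j ^ N j := by
    rw [X_pow_eq_monomial, monomial_mul, mul_one, tsub_add_cancel_of_le]
    simpa using hj
  rw [this]
  exact Ideal.mul_mem_left _ _ (hN j)

lemma eval_smul_of_isHomogeneous {d : ℕ} {g : Poly d} {a : ℕ} (hg : g.IsHomogeneous a) (t : ℂ)
    (x : Fin d → ℂ) : eval (t • x) g = t ^ a * eval x g := by
  rw [eval_eq, eval_eq, Finset.mul_sum]
  refine Finset.sum_congr rfl fun m hm => ?_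
  have hdeg : m.degree = a := by
    by_contra h
    exact (mem_support_iff.1 hm) (hg.coeff_eq_zero h)
  have : ∏ i ∈ m.support, (t • x) i ^ m i = t ^ a * ∏ i ∈ m.support, x i ^ m i := by
    simp only [Pi.smul_apply, smul_eq_mul, mul_pow, Finset.prod_mul_distrib,
      Finset.prod_pow_eq_pow_sum]
    rw [← hdeg]; rfl
  rw [this]; ring

lemma eval_zero_of_isHomogeneous {d : ℕ} {f : Poly d} {a : ℕ} (hf : f.IsHomogeneous a)
    (ha : 0 < a) : eval 0 f = 0 := by
  have := eval_smul_of_isHomogeneous hf 0 0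
  rwa [zero_smul, zero_pow ha.ne', zero_mul] at this

/-- The curve `{gⱼ = 0 for j ≠ i}` meets the hypersurface `gᵢ = 1` in finitely many points. -/
lemma OnlyZero.finite_slice {d : ℕ} {ι : Type*} [Fintype ι] {g : ι → Poly d} {e : ι → ℕ}
    (hg : ∀ i, (g i).IsHomogeneous (e i)) (he : ∀ i, 0 < e i) (hV : OnlyZero g) (i : ι) :
    {x : Fin d → ℂ | (∀ j, j ≠ i → eval x (g j) = 0) ∧ eval x (g i) = 1}.Finite := by
  set S := {x : Fin d → ℂ | (∀ j, j ≠ i → eval x (g j) = 0) ∧ eval x (g i) = 1} with hS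
  let φ : Poly d →ₐ[ℂ] (S → ℂ) := AlgHom.pi fun x => aeval x.1
  have hφ : ∀ f x, φ f x = eval x.1 f := fun f x => by simp [φ]
  obtain ⟨E, hE⟩ := hV.exists_isHomogeneous_mem
  -- On `S` a form `f = ∑ qⱼ gⱼ` agrees with `qᵢ`, because `gᵢ = 1` and the other `gⱼ` vanish. As
  -- `qᵢ` may be taken of lower degree, every polynomial agrees on `S` with one of degree at most
  -- `E`.
  have hU : ∀ f : Poly d, f ∈ LinearMap.ker φ.toLinearMap ⊔ restrictTotalDegree (Fin d) ℂ E := by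
    have key : ∀ n, ∀ f : Poly d, f.IsHomogeneous n →
        f ∈ LinearMap.ker φ.toLinearMap ⊔ restrictTotalDegree (Fin d) ℂ E := by
      intro n
      induction n using Nat.strong_induction_on with
      | _ n ih =>
      intro f hf
      by_cases hn : n ≤ E
      · refine Submodule.mem_sup_right ?_
        rw [mem_restrictTotalDegree]
        exact hf.totalDegree_le.trans hn
      obtain ⟨q, hq⟩ := (Ideal.mem_span_range_iff_exists_fun (R := Poly d)).1 (hE n (by omega) f hf)
      have h1 : f = ∑ j, shiftComp n (e j) (q j) * g j := by
        rw [sum_shiftComp_mul hg, hq]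
        exact (homogeneousComponent_eq_self hf).symm
      have h2 : f = (f - shiftComp n (e i) (q i)) + shiftComp n (e i) (q i) := by ring
      rw [h2]
      refine add_mem (Submodule.mem_sup_left ?_) ?_
      · rw [LinearMap.mem_ker]
        funext x
        change φ _ x = 0
        rw [hφ, map_sub]
        conv_lhs => rw [h1]
        rw [map_sum, Finset.sum_eq_single i]
        · rw [map_mul, x.2.2, mul_one, sub_self]
        · intro j _ hj
          rw [map_mul, x.2.1 j hj, mul_zero]
        · simp
      · by_cases hn' : e i ≤ n
        · refine ih (n - e i) (by have := he i; omega) _ ?_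
          rw [shiftComp, if_pos hn']
          exact homogeneousComponent_isHomogeneous _ _
        · rw [shiftComp_eq_zero (by omega)]
          exact zero_mem _
    intro f
    rw [← sum_homogeneousComponent f]
    exact Submodule.sum_mem _ fun n _ => key n _ (homogeneousComponent_isHomogeneous _ _)
  have hfin : Module.Finite ℂ φ.range := by
    have h1 : (restrictTotalDegree (Fin d) ℂ E).map φ.toLinearMap =
        Subalgebra.toSubmodule φ.range := by
      apply le_antisymm
      · rintro _ ⟨f, _, rfl⟩
        exact ⟨f, rfl⟩
      · rintro _ ⟨f, rfl⟩
        obtain ⟨a, ha, b, hb, rfl⟩ := Submodule.mem_sup.1 (hU f)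
        refine ⟨b, hb, ?_⟩
        have : φ a = 0 := ha
        simp [this]
    have h2 : (restrictTotalDegree (Fin d) ℂ E).FG := by
      have : (restrictTotalDegree (Fin d) ℂ E) =
          Submodule.span ℂ ((fun m => monomial m (1 : ℂ)) '' {m : Fin d →₀ ℕ | m.degree ≤ E}) := by
        apply le_antisymm
        · intro f hf
          rw [f.as_sum]
          refine Submodule.sum_mem _ fun m hm => ?_
          rw [← mul_one (coeff m f), ← smul_eq_mul, ← smul_monomial]
          refine Submodule.smul_mem _ _ (Submodule.subset_span ⟨m, ?_, rfl⟩)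
          exact (le_totalDegree hm).trans ((mem_restrictTotalDegree _ _ _).1 hf)
        · rw [Submodule.span_le]
          rintro _ ⟨m, hm, rfl⟩
          rw [SetLike.mem_coe, mem_restrictTotalDegree]
          exact (totalDegree_monomial_le _ _).trans hm
      rw [this]
      exact Submodule.fg_span ((Finsupp.finite_of_degree_le E).image _)
    have h3 := h2.map φ.toLinearMap
    rw [h1] at h3
    exact Module.Finite.iff_fg.2 h3
  -- The algebra of polynomial functions on `S` is finite-dimensional, so each coordinate is
  -- integral over `ℂ` and takes only finitely many values.
  have hint : ∀ k, ∃ q : Polynomial ℂ, q ≠ 0 ∧ ∀ x ∈ S, q.eval (x k) = 0 := by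
    intro k
    obtain ⟨q, hq, hq0⟩ := Algebra.IsIntegral.isIntegral (R := ℂ)
      (⟨φ (X k), ⟨X k, rfl⟩⟩ : φ.range)
    refine ⟨q, hq.ne_zero, fun x hx => ?_⟩
    have h1 : Polynomial.aeval (φ (X k)) q = 0 := by
      have := congrArg φ.range.val hq0
      rw [← Polynomial.aeval_def, ← Polynomial.aeval_algHom_apply, map_zero] at this
      exact this
    have h2 := congrArg (Pi.evalAlgHom ℂ (fun _ : S => ℂ) ⟨x, hx⟩) h1
    rw [← Polynomial.aeval_algHom_apply, map_zero] at h2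
    have h3 : (Pi.evalAlgHom ℂ (fun _ : S => ℂ) ⟨x, hx⟩) (φ (X k)) = x k := by
      simp [hφ]
    rw [h3] at h2
    simpa [Polynomial.aeval_def] using h2
  choose q hq0 hq using hint
  refine (Set.Finite.pi' (t := fun k => {z : ℂ | (q k).eval z = 0}) fun k => ?_).subset
    fun x hx k => hq k x hx
  refine (Polynomial.finite_setOfPred_isRoot (hq0 k)).subset fun z hz => hz

/-- A common linear form by which a member of each of two systems can be replaced. -/
lemma OnlyZero.exists_linear {d : ℕ} {ι : Type*} [Fintype ι] [DecidableEq ι] {g h : ι → Poly d}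
    {e e' : ι → ℕ} (hg : ∀ i, (g i).IsHomogeneous (e i)) (he : ∀ i, 0 < e i) (hV : OnlyZero g)
    (hh : ∀ i, (h i).IsHomogeneous (e' i)) (he' : ∀ i, 0 < e' i) (hV' : OnlyZero h) (i : ι) :
    ∃ l : Poly d, l.IsHomogeneous 1 ∧ OnlyZero (Function.update g i l) ∧
      OnlyZero (Function.update h i l) := by
  have hS := hV.finite_slice hg he i
  have hS' := hV'.finite_slice hh he' i
  have := (hS.union hS').to_subtype
  obtain ⟨φ, hφ⟩ := Module.exists_dual_forall_apply_ne_zero (K := ℂ)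
    (fun x : ↥({x : Fin d → ℂ | (∀ j, j ≠ i → eval x (g j) = 0) ∧ eval x (g i) = 1} ∪
      {x : Fin d → ℂ | (∀ j, j ≠ i → eval x (h j) = 0) ∧ eval x (h i) = 1}) => x.1) (by
      rintro ⟨x, hx | hx⟩ (rfl : x = 0)
      · exact one_ne_zero (hx.2.symm.trans (eval_zero_of_isHomogeneous (hg i) (he i)))
      · exact one_ne_zero (hx.2.symm.trans (eval_zero_of_isHomogeneous (hh i) (he' i))))
  set l : Poly d := ∑ j, C (φ (Pi.single j 1)) * X j with hl
  have hlx : ∀ x, eval x l = φ x := by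
    intro x
    conv_rhs => rw [pi_eq_sum_univ' x, map_sum]
    simp only [hl, map_sum, map_mul, eval_C, eval_X]
    refine Finset.sum_congr rfl fun j _ => ?_
    rw [map_smul, smul_eq_mul, mul_comm]
  have concl : ∀ (f : ι → Poly d) (a : ι → ℕ), (∀ i, (f i).IsHomogeneous (a i)) →
      (∀ i, 0 < a i) → OnlyZero f → (∀ x : Fin d → ℂ, (∀ j, j ≠ i → eval x (f j) = 0) →
      eval x (f i) = 1 → φ x ≠ 0) → OnlyZero (Function.update f i l) := by
    intro f a hf ha hfV hne x hx
    have hxj : ∀ j, j ≠ i → eval x (f j) = 0 := fun j hj => by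
      have := hx j
      rwa [Function.update_of_ne hj] at this
    have hxi : φ x = 0 := by
      have := hx i
      rwa [Function.update_self, hlx] at this
    by_contra hx0
    have hfi : eval x (f i) ≠ 0 := by
      intro h0
      refine hx0 (hfV x fun j => ?_)
      by_cases hj : j = i
      · rw [hj, h0]
      · exact hxj j hj
    -- A nonzero common zero of `l` and the other forms can be rescaled into the slice `f i = 1`,
    -- where `φ` was chosen not to vanish.
    obtain ⟨t, ht⟩ := IsAlgClosed.exists_pow_nat_eq (eval x (f i))⁻¹ (ha i)
    refine hne (t • x) (fun j hj => ?_) ?_ ?_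
    · rw [eval_smul_of_isHomogeneous (hf j), hxj j hj, mul_zero]
    · rw [eval_smul_of_isHomogeneous (hf i), ht, inv_mul_cancel₀ hfi]
    · rw [map_smul, hxi, smul_zero]
  refine ⟨l, ?_, concl g e hg he hV fun x h1 h2 => hφ ⟨x, Or.inl ⟨h1, h2⟩⟩,
    concl h e' hh he' hV' fun x h1 h2 => hφ ⟨x, Or.inr ⟨h1, h2⟩⟩⟩
  exact IsHomogeneous.sum _ _ _ fun j _ => isHomogeneous_C_mul_X _ _

lemma isHomogeneous_update {d : ℕ} {ι : Type*} [DecidableEq ι] {g : ι → Poly d} {e : ι → ℕ}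
    (hg : ∀ i, (g i).IsHomogeneous (e i)) (i : ι) {l : Poly d} {a : ℕ} (hl : l.IsHomogeneous a)
    (j : ι) : (Function.update g i l j).IsHomogeneous (Function.update e i a j) := by
  by_cases hj : j = i
  · subst hj; simpa using hl
  · simpa [hj] using hg j

lemma update_pos {ι : Type*} [DecidableEq ι] {e : ι → ℕ} (he : ∀ i, 0 < e i) (i j : ι) :
    0 < Function.update e i 1 j := by
  by_cases hj : j = i
  · subst hj; simp
  · simpa [hj] using he j

/-- Koszul exactness is transported from `h` to `g` one index at a time. At `i` both members are
replaced by a common linear form `l`: the exchange leads from `h` to `h` with `l`, the induction to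
`g` with `l`, and a second exchange puts `g i` back. -/
lemma koszulExact_of_eqOn_compl {d : ℕ} {ι : Type*} [Fintype ι] [DecidableEq ι] (T : Finset ι) :
    ∀ (g h : ι → Poly d) (e e' : ι → ℕ), (∀ i, (g i).IsHomogeneous (e i)) → (∀ i, 0 < e i) →
      OnlyZero g → (∀ i, (h i).IsHomogeneous (e' i)) → (∀ i, 0 < e' i) → OnlyZero h →
      (∀ i, i ∉ T → g i = h i) → KoszulExact h → KoszulExact g := by
  induction T using Finset.induction_on with
  | empty =>
    intro g h _ _ _ _ _ _ _ _ hT hK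
    rwa [show g = h from funext fun i => hT i (Finset.notMem_empty i)]
  | insert i T _ ih =>
    intro g h e e' hg he hV hh he' hV' hT hK
    obtain ⟨l, hl, hlg, hlh⟩ := OnlyZero.exists_linear hg he hV hh he' hV' i
    obtain ⟨N, hN⟩ := hlh.exists_pow_mem (eval_zero_of_isHomogeneous (hh i) (he' i))
    have K1 : KoszulExact (Function.update h i l) := hK.exchange hh he' i l N hN
    have K2 : KoszulExact (Function.update g i l) :=
      ih _ _ (Function.update e i 1) (Function.update e' i 1) (isHomogeneous_update hg i hl)
        (update_pos he i) hlg (isHomogeneous_update hh i hl) (update_pos he' i) hlh (by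
          intro j hj
          by_cases hji : j = i
          · subst hji; simp
          · simp [hji, hT j (by simp [hji, hj])]) K1
    obtain ⟨N', hN'⟩ := hV.exists_pow_mem (eval_zero_of_isHomogeneous hl one_pos)
    have := K2.exchange (isHomogeneous_update hg i hl) (update_pos he i) i (g i) N' (by
      rw [Function.update_idem, Function.update_eq_self, Function.update_self]
      exact hN')
    rwa [Function.update_idem, Function.update_eq_self] at this

/-- As many forms of positive degree as variables, without a common zero outside the origin,
have only the trivial syzygies. -/
theorem OnlyZero.koszulExact {d : ℕ} {g : Fin d → Poly d} {e : Fin d → ℕ}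
    (hg : ∀ i, (g i).IsHomogeneous (e i)) (he : ∀ i, 0 < e i) (hV : OnlyZero g) :
    KoszulExact g :=
  koszulExact_of_eqOn_compl Finset.univ g (fun i => X i) e (fun _ => 1) hg he hV
    (fun i => isHomogeneous_X ℂ i) (fun _ => one_pos) (fun x hx => funext fun i => by simpa using hx i)
    (fun i hi => absurd (Finset.mem_univ i) hi) (koszulExact_X d)

/-! ### Degree-bounded representations of the elements of the ideal -/

/-- All monomials of `q` have degree at most `n - e`; in particular `q = 0` if `n < e`. -/
def DegBound {d : ℕ} (n e : ℕ) (q : Poly d) : Prop := ∀ m ∈ q.support, m.degree + e ≤ n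

section DegBound
variable {d : ℕ} {n e : ℕ}

lemma DegBound.mono {n' : ℕ} (h : n ≤ n') {q : Poly d} (hq : DegBound n e q) : DegBound n' e q :=
  fun m hm => (hq m hm).trans h

lemma degBound_zero : DegBound n e (0 : Poly d) := fun m hm => by simp at hm

lemma DegBound.add {f g : Poly d} (hf : DegBound n e f) (hg : DegBound n e g) :
    DegBound n e (f + g) := fun m hm => by
  rcases Finset.mem_union.1 (support_add hm) with h | h
  · exact hf m h
  · exact hg m h

lemma DegBound.sum {ι : Type*} (s : Finset ι) {f : ι → Poly d} (hf : ∀ i ∈ s, DegBound n e (f i)) :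
    DegBound n e (∑ i ∈ s, f i) := by
  classical
  induction s using Finset.induction_on with
  | empty => exact degBound_zero
  | insert i s hi ih =>
    rw [Finset.sum_insert hi]
    exact (hf i (Finset.mem_insert_self i s)).add (ih fun j hj => hf j (Finset.mem_insert_of_mem hj))

lemma DegBound.neg {f : Poly d} (hf : DegBound n e f) : DegBound n e (-f) := fun m hm =>
  hf m (by rwa [support_neg] at hm)

lemma degBound_iff {f : Poly d} : DegBound n 0 f ↔ f.totalDegree ≤ n :=
  ⟨fun h => Finset.sup_le fun m hm => h m hm,
    fun h _ hm => (le_totalDegree hm).trans h⟩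

lemma DegBound.mul {a : ℕ} {q p : Poly d} (hq : DegBound n (e + a) q)
    (hp : ∀ m ∈ p.support, m.degree ≤ a) : DegBound n e (q * p) := by
  classical
  intro m hm
  obtain ⟨m₁, h₁, m₂, h₂, rfl⟩ := Finset.mem_add.1 (support_mul q p hm)
  have := hq m₁ h₁
  have := hp m₂ h₂
  rw [map_add]
  omega

lemma DegBound.C_mul {f : Poly d} (hf : DegBound n e f) (c : ℂ) : DegBound n e (C c * f) := by
  intro m hm
  refine hf m ?_
  rw [mem_support_iff, coeff_C_mul] at hm
  exact mem_support_iff.2 (right_ne_zero_of_mul hm)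

lemma degBound_of_shiftComp_eq {f : Poly d} (h : shiftComp n e f = f) : DegBound n e f := by
  intro m hm
  rw [← h, shiftComp] at hm
  split_ifs at hm with he
  · rw [mem_support_iff, coeff_homogeneousComponent] at hm
    have : m.degree = n - e := by
      by_contra h'
      simp [h'] at hm
    omega
  · simp at hm

lemma DegBound.shiftComp_eq_zero {f : Poly d} (hf : DegBound n (e + 1) f) :
    shiftComp n e f = 0 := by
  rw [shiftComp]
  split_ifs with he
  · refine homogeneousComponent_eq_zero' _ _ fun m hm h => ?_
    have := hf m hm
    omega
  · rfl

lemma DegBound.of_shiftComp_eq_zero {f : Poly d} (hf : DegBound (n + 1) e f)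
    (h : shiftComp (n + 1) e f = 0) : DegBound n e f := by
  intro m hm
  have h1 := hf m hm
  by_contra h2
  have h3 := congrArg (coeff m) h
  rw [shiftComp, if_pos (by omega), coeff_homogeneousComponent, if_pos (by omega), coeff_zero] at h3
  exact mem_support_iff.1 hm h3

/-- The part of `p` below its leading form contributes only in degrees below `n - e`. -/
lemma DegBound.shiftComp_mul {q p : Poly d} (hq : DegBound n (e + p.totalDegree) q)
    (hp : 0 < p.totalDegree) : shiftComp n e (q * p) =
      shiftComp n (e + p.totalDegree) q * homogeneousComponent p.totalDegree p := by
  set t := homogeneousComponent p.totalDegree p with ht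
  have h1 : q * p = q * t + q * (p - t) := by ring
  have h2 : DegBound n (e + 1) (q * (p - t)) := by
    refine DegBound.mul (a := p.totalDegree - 1) ?_ fun m hm => ?_
    · rwa [show e + 1 + (p.totalDegree - 1) = e + p.totalDegree by omega]
    · rw [mem_support_iff, coeff_sub, ht, coeff_homogeneousComponent] at hm
      split_ifs at hm with h
      · simp at hm
      · have : m.degree ≤ p.totalDegree := le_totalDegree (mem_support_iff.2 (by simpa using hm))
        omega
  rw [h1, map_add, h2.shiftComp_eq_zero, add_zero,
    Macaulay.shiftComp_mul (homogeneousComponent_isHomogeneous _ _)]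

end DegBound

/-- If `p i` were zero, the unit vector at `i` would be a syzygy of the leading forms. Koszul
exactness would then write `1` as a combination of forms vanishing at the origin. -/
lemma NoRootsAtInfinity.totalDegree_pos {d : ℕ} {p : Fin d → Poly d} (hinf : NoRootsAtInfinity p)
    (hp : ∀ i, p i = 0 ∨ 0 < (p i).totalDegree) (i : Fin d) : 0 < (p i).totalDegree := by
  refine (hp i).resolve_left fun hi => ?_
  -- The zero polynomial is homogeneous of every degree; degree `1` is assigned to it to keep all
  -- degrees positive.
  let e : Fin d → ℕ := fun j => max 1 (p j).totalDegree
  have hg : ∀ j, (homogeneousComponent (p j).totalDegree (p j)).IsHomogeneous (e j) := by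
    intro j
    rcases hp j with h | h
    · simp only [h, map_zero]
      exact isHomogeneous_zero _ _ _
    · rw [show e j = (p j).totalDegree from max_eq_right h]
      exact homogeneousComponent_isHomogeneous _ _
  have he : ∀ j, 0 < e j := fun j => lt_of_lt_of_le one_pos (le_max_left _ _)
  obtain ⟨A, -, -, hA⟩ := OnlyZero.koszulExact hg he hinf (Pi.single i 1) (by
    simp [Pi.single_apply, hi])
  have := congrArg (eval 0) (hA i)
  simp only [Pi.single_eq_same, map_one, map_sum, map_mul,
    eval_zero_of_isHomogeneous (hg _) (he _), mul_zero, Finset.sum_const_zero] at this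
  exact one_ne_zero this

/-- If the degree bound of a representation exceeds `deg f`, the top parts of the `q i` form a
syzygy of the leading forms, given by a skew matrix `A`. Subtracting `∑ A i j * p j` from `q i`
cancels these top parts, and by skewness does not change `∑ q i * p i`. -/
theorem NoRootsAtInfinity.exists_degBound {d : ℕ} {p : Fin d → Poly d}
    (hinf : NoRootsAtInfinity p) {f : Poly d} (hf : f ∈ systemIdeal p) {N : ℕ}
    (hN : f.totalDegree ≤ N) :
    ∃ q : Fin d → Poly d, f = ∑ i, q i * p i ∧ ∀ i, DegBound N (p i).totalDegree (q i) := by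
  by_cases hconst : ∃ i, p i ≠ 0 ∧ (p i).totalDegree = 0
  · obtain ⟨i, hi, hi0⟩ := hconst
    have hC := totalDegree_eq_zero_iff_eq_C.1 hi0
    have hc : coeff 0 (p i) ≠ 0 := fun h => hi (by rw [hC, h, C_0])
    refine ⟨Pi.single i (C (coeff 0 (p i))⁻¹ * f), ?_, fun j => ?_⟩
    · rw [Finset.sum_eq_single i (fun j _ hj => by simp [hj]) (by simp), Pi.single_eq_same]
      conv_rhs => rw [hC]
      rw [coeff_C, if_pos rfl, mul_right_comm, ← C_mul, inv_mul_cancel₀ hc, C_1, one_mul]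
    · by_cases hj : j = i
      · subst hj
        rw [Pi.single_eq_same, hi0]
        exact (degBound_iff.2 hN).C_mul _
      · rw [Pi.single_eq_of_ne hj]
        exact degBound_zero
  have hpos := hinf.totalDegree_pos fun i => by
    by_cases h : p i = 0
    · exact Or.inl h
    · exact Or.inr (Nat.pos_of_ne_zero fun h0 => hconst ⟨i, h, h0⟩)
  set g : Fin d → Poly d := fun i => homogeneousComponent (p i).totalDegree (p i) with hgdef
  have hg : ∀ i, (g i).IsHomogeneous (p i).totalDegree :=
    fun i => homogeneousComponent_isHomogeneous _ _
  have hK : KoszulExact g := OnlyZero.koszulExact hg hpos hinf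
  have key : ∀ n (q : Fin d → Poly d), f = ∑ i, q i * p i →
      (∀ i, DegBound n (p i).totalDegree (q i)) →
      ∃ q : Fin d → Poly d, f = ∑ i, q i * p i ∧ ∀ i, DegBound N (p i).totalDegree (q i) := by
    intro n
    induction n with
    | zero => exact fun q h1 h2 => ⟨q, h1, fun i => (h2 i).mono (Nat.zero_le _)⟩
    | succ n ih =>
      intro q h1 h2
      by_cases hn : n + 1 ≤ N
      · exact ⟨q, h1, fun i => (h2 i).mono hn⟩
      have hs : ∑ i, shiftComp (n + 1) (p i).totalDegree (q i) * g i = 0 := by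
        have h3 : homogeneousComponent (n + 1) f = 0 :=
          homogeneousComponent_eq_zero _ _ (by omega)
        rw [h1, map_sum] at h3
        rw [← h3]
        refine Finset.sum_congr rfl fun i _ => ?_
        have := DegBound.shiftComp_mul (e := 0) (by rw [zero_add]; exact h2 i) (hpos i)
        rw [shiftComp_zero_right, zero_add] at this
        exact this.symm
      obtain ⟨A, -, hskew, hdeg, hA⟩ := hK.graded hg (fun i => shiftComp_shiftComp _ _ _) hs
      have hAb : ∀ i j, DegBound (n + 1) ((p i).totalDegree + (p j).totalDegree) (A i j) :=
        fun i j => degBound_of_shiftComp_eq (hdeg i j)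
      refine ih (fun i => q i + - ∑ j, A i j * p j) ?_ fun i => ?_
      · have h0 : ∑ i, (∑ j, A i j * p j) * p i = 0 := by
          have h4 : ∑ i, (∑ j, A i j * p j) * p i = - ∑ i, (∑ j, A i j * p j) * p i := by
            conv_lhs => simp only [Finset.sum_mul]
            rw [Finset.sum_comm, ← Finset.sum_neg_distrib]
            refine Finset.sum_congr rfl fun i _ => ?_
            rw [Finset.sum_mul, ← Finset.sum_neg_distrib]
            exact Finset.sum_congr rfl fun j _ => by rw [hskew j i]; ring
          exact self_eq_neg.1 h4
        simp only [add_mul, neg_mul, Finset.sum_add_distrib, Finset.sum_neg_distrib, h0, neg_zero,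
          add_zero]
        exact h1
      · refine DegBound.of_shiftComp_eq_zero ((h2 i).add (DegBound.neg (DegBound.sum _ fun j _ =>
          (hAb i j).mul fun m hm => le_totalDegree hm))) ?_
        rw [map_add, map_neg, map_sum, hA i, ← sub_eq_add_neg, sub_eq_zero]
        refine Finset.sum_congr rfl fun j _ => ?_
        rw [(hAb i j).shiftComp_mul (hpos j), hdeg]
  obtain ⟨q, hq⟩ := (Ideal.mem_span_range_iff_exists_fun (R := Poly d)).1 hf
  refine key (∑ i, ((q i).totalDegree + (p i).totalDegree)) q hq.symm fun i m hm => ?_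
  have h1 : m.degree ≤ (q i).totalDegree := le_totalDegree hm
  have h2 := Finset.single_le_sum (f := fun i => (q i).totalDegree + (p i).totalDegree)
    (fun _ _ => Nat.zero_le _) (Finset.mem_univ i)
  omega

/-- The elements of degree at most `ρ` of the ideal are combinations of the system rows. -/
theorem NoRootsAtInfinity.mem_span_sysRowPoly {d : ℕ} {p : Fin d → Poly d}
    (hinf : NoRootsAtInfinity p) {f : Poly d} (hf : f ∈ systemIdeal p)
    (hN : f.totalDegree ≤ rho p) : f ∈ Submodule.span ℂ (Set.range (sysRowPoly p)) := by
  obtain ⟨q, rfl, hq⟩ := hinf.exists_degBound hf hN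
  refine Submodule.sum_mem _ fun i _ => ?_
  rw [(q i).as_sum, Finset.sum_mul]
  refine Submodule.sum_mem _ fun m hm => ?_
  have : monomial m (coeff m (q i)) * p i = coeff m (q i) • sysRowPoly p ⟨(i, m), hq i m hm⟩ := by
    rw [sysRowPoly, ← smul_mul_assoc, smul_monomial, smul_eq_mul, mul_one]
  rw [this]
  exact Submodule.smul_mem _ _ (Submodule.subset_span ⟨_, rfl⟩)

/-! ### The quotient matrix at a root -/

/-- Division of a polynomial by the maximal ideal of a point, with control of the degrees. -/
lemma exists_eq_sum_mul_X_sub_C {d : ℕ} (x : Fin d → ℂ) (f : Poly d) :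
    ∃ q : Fin d → Poly d, f = C (eval x f) + ∑ j, q j * (X j - C (x j)) ∧
      ∀ j, DegBound f.totalDegree 1 (q j) := by
  have hmon : ∀ n, ∀ m : Fin d →₀ ℕ, m.degree = n → ∃ q : Fin d → Poly d,
      monomial m (1 : ℂ) = C (eval x (monomial m 1)) + ∑ j, q j * (X j - C (x j)) ∧
      ∀ j, DegBound n 1 (q j) := by
    intro n
    induction n with
    | zero =>
      intro m hm
      rw [Finsupp.degree_eq_zero_iff] at hm
      subst hm
      exact ⟨0, by simp, fun _ => degBound_zero⟩
    | succ n ih =>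
      intro m hm
      obtain ⟨k, hk⟩ : ∃ k, m k ≠ 0 := by
        by_contra! h
        rw [show m = 0 from Finsupp.ext h] at hm
        simp at hm
      have hle : Finsupp.single k 1 ≤ m := by
        simpa using Nat.one_le_iff_ne_zero.2 hk
      obtain ⟨m', rfl⟩ := exists_add_of_le hle
      have hm' : m'.degree = n := by
        rw [map_add, Finsupp.degree_single] at hm
        omega
      obtain ⟨q, hq, hqd⟩ := ih m' hm'
      refine ⟨fun j => C (x k) * q j + (if j = k then monomial m' 1 else 0), ?_, fun j => ?_⟩
      · have h1 : (monomial (Finsupp.single k 1 + m') (1 : ℂ) : Poly d) = X k * monomial m' 1 := by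
          rw [X, monomial_mul, one_mul]
        have h2 : ∑ j, (C (x k) * q j + (if j = k then monomial m' 1 else 0)) * (X j - C (x j)) =
            C (x k) * ∑ j, q j * (X j - C (x j)) + monomial m' 1 * (X k - C (x k)) := by
          simp only [add_mul, Finset.sum_add_distrib, Finset.mul_sum, mul_assoc, ite_mul, zero_mul,
            Finset.sum_ite_eq', Finset.mem_univ, if_true]
        rw [h1, h2, map_mul, eval_X, C_mul]
        linear_combination C (x k) * hq
      · refine (((hqd j).mono (Nat.le_succ n)).C_mul _).add ?_
        split_ifs
        · intro m hm
          have := support_monomial_subset hm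
          rw [Finset.mem_singleton] at this
          rw [this, hm']
        · exact degBound_zero
  choose q hq hqd using fun m : Fin d →₀ ℕ => hmon m.degree m rfl
  refine ⟨fun j => ∑ m ∈ f.support, C (coeff m f) * q m j, ?_, fun j => DegBound.sum _ fun m hm =>
    ((hqd m j).mono (le_totalDegree hm)).C_mul _⟩
  have h1 : ∑ j, (∑ m ∈ f.support, C (coeff m f) * q m j) * (X j - C (x j)) =
      ∑ m ∈ f.support, C (coeff m f) * ∑ j, q m j * (X j - C (x j)) := by
    simp only [Finset.sum_mul, Finset.mul_sum, mul_assoc]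
    exact Finset.sum_comm
  have h2 : ∀ m, (monomial m (coeff m f) : Poly d) = C (coeff m f) * monomial m 1 := fun m => by
    rw [C_mul_monomial, mul_one]
  rw [h1]
  conv_lhs => rw [f.as_sum]
  conv_rhs => enter [1, 2]; rw [f.as_sum]
  rw [map_sum, map_sum, ← Finset.sum_add_distrib]
  refine Finset.sum_congr rfl fun m _ => ?_
  rw [h2, map_mul, C_mul, eval_C, ← mul_add, ← hq m]

section Root
variable {d : ℕ} {p : Fin d → Poly d} {x : Fin d → ℂ} {Q : Matrix (Fin d) (Fin d) (Poly d)}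

/-- Differentiating `p = Q (X - x)` at `x` gives `Q(x) = J(x)`. -/
lemma eval_det_eq_det_jacobian (hQ : ∀ i, p i = ∑ j, Q i j * (X j - C (x j))) :
    eval x Q.det = (jacobian p x).det := by
  rw [RingHom.map_det]
  congr 1
  ext i k
  rw [RingHom.mapMatrix_apply, Matrix.map_apply, jacobian, Matrix.of_apply, hQ i, map_sum, map_sum,
    Finset.sum_eq_single k]
  · simp
  · intro j _ hj
    simp [pderiv_X_of_ne hj]
  · simp

/-- Multiplying `p = Q (X - x)` by the adjugate of `Q` puts each `det Q * (X j - x j)` in the ideal,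
and `f` is a combination of the `X j - x j`. -/
lemma det_mul_mem (hQ : ∀ i, p i = ∑ j, Q i j * (X j - C (x j))) {f : Poly d}
    (hf : eval x f = 0) : Q.det * f ∈ systemIdeal p := by
  have hX : ∀ j, Q.det * (X j - C (x j)) ∈ systemIdeal p := by
    intro j
    have h1 : Q.mulVec (fun j => X j - C (x j)) = p := funext fun i => (hQ i).symm
    have h2 := congrFun (congrArg (Q.adjugate.mulVec) h1) j
    rw [Matrix.mulVec_mulVec, Matrix.adjugate_mul, Matrix.smul_mulVec, Matrix.one_mulVec,
      Pi.smul_apply, smul_eq_mul] at h2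
    rw [h2, Matrix.mulVec, dotProduct]
    exact Ideal.sum_mem _ fun i _ =>
      Ideal.mul_mem_left _ _ (Ideal.subset_span (Set.mem_range_self i))
  obtain ⟨q, hq, -⟩ := exists_eq_sum_mul_X_sub_C x f
  rw [hf, C_0, zero_add] at hq
  rw [hq, Finset.mul_sum]
  refine Ideal.sum_mem _ fun j _ => ?_
  rw [mul_left_comm]
  exact Ideal.mul_mem_left _ _ (hX j)

lemma eval_eq_zero_of_mem (hx : IsSystemRoot p x) {f : Poly d} (hf : f ∈ systemIdeal p) :
    eval x f = 0 := by
  have : systemIdeal p ≤ RingHom.ker (eval x) := by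
    rw [Ideal.span_le]
    rintro _ ⟨i, rfl⟩
    exact hx i
  exact this hf

lemma eval_det_eq_zero (hQ : ∀ i, p i = ∑ j, Q i j * (X j - C (x j))) {y : Fin d → ℂ}
    (hy : IsSystemRoot p y) (hxy : y ≠ x) : eval y Q.det = 0 := by
  obtain ⟨j, hj⟩ := Function.ne_iff.1 hxy
  have := eval_eq_zero_of_mem hy (det_mul_mem hQ (f := X j - C (x j)) (by simp))
  rw [map_mul, map_sub, eval_X, eval_C] at this
  exact (mul_eq_zero.1 this).resolve_right (sub_ne_zero.2 hj)

lemma exists_quotientMatrix (hx : IsSystemRoot p x) : ∃ Q : Matrix (Fin d) (Fin d) (Poly d),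
    (∀ i, p i = ∑ j, Q i j * (X j - C (x j))) ∧
      ∀ i j, DegBound (p i).totalDegree 1 (Q i j) := by
  choose Q hQ hQd using fun i => exists_eq_sum_mul_X_sub_C x (p i)
  refine ⟨Q, fun i => ?_, hQd⟩
  have := hQ i
  rwa [hx i, C_0, zero_add] at this

lemma det_jacobian_ne_zero (hJ : IsUnit (jacobian p x)) : (jacobian p x).det ≠ 0 :=
  ((Matrix.isUnit_iff_isUnit_det _).1 hJ).ne_zero

lemma totalDegree_pos_of_isUnit_jacobian (hJ : IsUnit (jacobian p x))
    (i : Fin d) : 0 < (p i).totalDegree := by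
  by_contra h
  have hC := totalDegree_eq_zero_iff_eq_C.1 (show (p i).totalDegree = 0 by omega)
  refine det_jacobian_ne_zero hJ (Matrix.det_eq_zero_of_row_eq_zero i fun j => ?_)
  rw [jacobian, Matrix.of_apply, hC, pderiv_C, map_zero]

lemma totalDegree_det_le (hpos : ∀ i, 0 < (p i).totalDegree)
    (hQ : ∀ i j, DegBound (p i).totalDegree 1 (Q i j)) : Q.det.totalDegree ≤ rho p := by
  have hQ' : ∀ i j, (Q i j).totalDegree ≤ (p i).totalDegree - 1 := fun i j =>
    Finset.sup_le fun m hm => Nat.le_sub_of_add_le (hQ i j m hm)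
  have hsum : ∑ i, ((p i).totalDegree - 1) ≤ rho p := by
    have : ∑ i, ((p i).totalDegree - 1) + d = ∑ i, (p i).totalDegree := by
      have h1 : ∑ i, ((p i).totalDegree - 1 + 1) = ∑ i, (p i).totalDegree :=
        Finset.sum_congr rfl fun i _ => Nat.sub_add_cancel (hpos i)
      rw [← h1, Finset.sum_add_distrib]
      simp
    rw [rho]
    omega
  rw [Matrix.det_apply]
  refine totalDegree_finsetSum_le fun σ _ => ?_
  refine (totalDegree_smul_le _ _).trans ((totalDegree_finsetProd _ _).trans ?_)
  refine (Finset.sum_le_sum fun i _ => hQ' (σ i) i).trans ?_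
  rw [Equiv.sum_comp σ fun i => (p i).totalDegree - 1]
  exact hsum

end Root

/-- If all roots are simple, the ideal contains every polynomial that vanishes at all roots. -/
theorem mem_systemIdeal_of_forall_eval_eq_zero {d : ℕ} {p : Fin d → Poly d}
    (hsimple : ∀ x, IsSystemRoot p x → IsUnit (jacobian p x)) {g : Poly d}
    (hg : ∀ x, IsSystemRoot p x → eval x g = 0) : g ∈ systemIdeal p := by
  -- `J` is the colon ideal `(I : g)`. If proper, it vanishes at some point `x`, which is a root
  -- because `I ≤ J`. But `g(x) = 0` gives `det Q ∈ J`, although `det Q` is nonzero at `x`.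
  let J : Ideal (Poly d) := Submodule.comap (LinearMap.toSpanSingleton (Poly d) (Poly d) g)
    (systemIdeal p)
  have hJ : ∀ f, f ∈ J ↔ f * g ∈ systemIdeal p := fun f => Iff.rfl
  by_cases htop : J = ⊤
  · have : (1 : Poly d) ∈ J := by rw [htop]; trivial
    rwa [hJ, one_mul] at this
  exfalso
  obtain ⟨M, hM, hJM⟩ := Ideal.exists_le_maximal J htop
  obtain ⟨x, rfl⟩ := isMaximal_iff_eq_vanishingIdeal_singleton.1 hM
  have hev : ∀ f ∈ J, eval x f = 0 := fun f hf => by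
    have := (mem_vanishingIdeal_singleton_iff x f).1 (hJM hf)
    simpa using this
  have hx : IsSystemRoot p x := fun i => hev _ ((hJ _).2
    (Ideal.mul_mem_right _ _ (Ideal.subset_span ⟨i, rfl⟩)))
  obtain ⟨Q, hQ, -⟩ := exists_quotientMatrix hx
  have := hev _ ((hJ _).2 (det_mul_mem hQ (hg x hx)))
  rw [eval_det_eq_det_jacobian hQ] at this
  exact det_jacobian_ne_zero (hsimple x hx) this

/-- Every class modulo the ideal contains a polynomial of degree at most `ρ`. -/
theorem exists_totalDegree_le_rho {d : ℕ} {p : Fin d → Poly d}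
    (hfin : {x | IsSystemRoot p x}.Finite)
    (hsimple : ∀ x, IsSystemRoot p x → IsUnit (jacobian p x)) (f : Poly d) :
    ∃ g : Poly d, g.totalDegree ≤ rho p ∧ f - g ∈ systemIdeal p := by
  choose Q hQ hQd using fun x : {x | IsSystemRoot p x} => exists_quotientMatrix x.2
  have := hfin.fintype
  -- Lagrange interpolation: each `det Q` vanishes at every root except its own.
  refine ⟨∑ x : {x | IsSystemRoot p x}, C (eval x.1 f / eval x.1 (Q x).det) * (Q x).det, ?_, ?_⟩
  · refine totalDegree_finsetSum_le fun x _ => ?_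
    refine (totalDegree_mul _ _).trans ?_
    rw [totalDegree_C, zero_add]
    exact totalDegree_det_le (totalDegree_pos_of_isUnit_jacobian (hsimple _ x.2)) (hQd x)
  · refine mem_systemIdeal_of_forall_eval_eq_zero hsimple fun y hy => ?_
    have hne : eval y (Q ⟨y, hy⟩).det ≠ 0 := by
      rw [eval_det_eq_det_jacobian (hQ ⟨y, hy⟩)]
      exact det_jacobian_ne_zero (hsimple y hy)
    rw [map_sub, map_sum, Finset.sum_eq_single ⟨y, hy⟩]
    · rw [map_mul, eval_C, div_mul_cancel₀ _ hne, sub_self]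
    · intro x _ hxy
      rw [map_mul, eval_det_eq_zero (hQ x) hy fun h => hxy (Subtype.ext h.symm), mul_zero]
    · simp

/-! ### Sensitivity of a simple eigenvalue -/

section Perturbation
variable {n : Type*} [Fintype n] [DecidableEq n]

/-- Fredholm alternative: a functional that vanishes on the range of `T` but not at `v` would be a
left null vector violating `h`. -/
lemma exists_mulVec_eq_of_forall_dotProduct_eq_zero (T : Matrix n n ℂ) (v : n → ℂ)
    (h : ∀ u, Matrix.vecMul u T = 0 → u ⬝ᵥ v = 0) : ∃ z, T.mulVec z = v := by
  by_contra hv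
  have hv' : v ∉ LinearMap.range T.mulVecLin := fun ⟨z, hz⟩ => hv ⟨z, hz⟩
  obtain ⟨φ, hφ, hφ0⟩ := Submodule.exists_le_ker_of_notMem hv'
  have hrep : ∀ a : n → ℂ, φ a = (fun i => φ (Pi.single i 1)) ⬝ᵥ a := fun a => by
    conv_lhs => rw [pi_eq_sum_univ' a, map_sum]
    refine Finset.sum_congr rfl fun i _ => ?_
    rw [map_smul, smul_eq_mul, mul_comm]
  refine hφ ?_
  rw [hrep]
  refine h _ (dotProduct_eq_zero _ fun a => ?_)
  rw [← Matrix.dotProduct_mulVec, ← hrep]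
  exact hφ0 ⟨a, rfl⟩

/-- The perturbations of rank one along the left and right eigenvectors bound the condition number
of an eigenvalue with one-dimensional left eigenspace from below. -/
theorem le_eigCond (A B : Matrix n n ℂ) (lam : ℂ) (y w : n → ℂ)
    (hy : (A - lam • B).mulVec y = 0)
    (hker : ∀ u, Matrix.vecMul u (A - lam • B) = 0 → ∃ c : ℂ, u = c • w)
    (hne : w ⬝ᵥ B.mulVec y ≠ 0) :
    ENNReal.ofReal (‖WithLp.toLp 2 w‖ * ‖WithLp.toLp 2 y‖ / ‖w ⬝ᵥ B.mulVec y‖) ≤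
      eigCond A B lam := by
  set T := A - lam • B with hT
  have hw0 : w ≠ 0 := fun h => hne (by rw [h, zero_dotProduct])
  have hy0 : y ≠ 0 := fun h => hne (by rw [h, Matrix.mulVec_zero, dotProduct_zero])
  have hwn : 0 < ‖WithLp.toLp 2 w‖ := norm_pos_iff.2 (by simpa using hw0)
  have hyn : 0 < ‖WithLp.toLp 2 y‖ := norm_pos_iff.2 (by simpa using hy0)
  have hww : w ⬝ᵥ star w = ((‖WithLp.toLp 2 w‖ ^ 2 : ℝ) : ℂ) := by
    rw [← EuclideanSpace.inner_toLp_toLp, inner_self_eq_norm_sq_to_K]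
    simp
  have hwn' : ((‖WithLp.toLp 2 w‖ ^ 2 : ℝ) : ℂ) ≠ 0 := by
    exact_mod_cast (pow_pos hwn 2).ne'
  set s := w ⬝ᵥ B.mulVec y with hs
  -- `t` makes `B y - t w̄` orthogonal to the left kernel, so that `T z = B y - t w̄` is solvable.
  set t : ℂ := s / ((‖WithLp.toLp 2 w‖ ^ 2 : ℝ) : ℂ) with ht
  obtain ⟨z, hz⟩ : ∃ z, T.mulVec z = B.mulVec y - t • star w := by
    refine exists_mulVec_eq_of_forall_dotProduct_eq_zero _ _ fun u hu => ?_
    obtain ⟨c, rfl⟩ := hker u hu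
    rw [smul_dotProduct, dotProduct_sub, dotProduct_smul, hww, ht, smul_eq_mul, smul_eq_mul,
      div_mul_cancel₀ _ hwn', ← hs, sub_self, mul_zero]
  -- The vector `v Δ` satisfies `(T - Δ B) v = -Δ r` exactly, with no higher-order remainder. A
  -- perturbation of `A` sending `v` to `Δ r` therefore shifts the eigenvalue by `Δ`.
  let v : ℝ → EuclideanSpace ℂ n := fun Δ => WithLp.toLp 2 (y + (Δ : ℂ) • z)
  let r : ℝ → EuclideanSpace ℂ n := fun Δ => WithLp.toLp 2 (t • star w + (Δ : ℂ) • B.mulVec z)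
  have hvc : Continuous v := by
    refine (PiLp.continuous_toLp 2 _).comp ?_
    fun_prop
  have hrc : Continuous r := by
    refine (PiLp.continuous_toLp 2 _).comp ?_
    fun_prop
  have hv0 : v 0 = WithLp.toLp 2 y := by simp [v]
  have hstar : ‖WithLp.toLp 2 (star w)‖ = ‖WithLp.toLp 2 w‖ := by
    simp [EuclideanSpace.norm_eq]
  have hr0 : ‖r 0‖ = ‖s‖ / ‖WithLp.toLp 2 w‖ := by
    have h1 : r 0 = t • WithLp.toLp 2 (star w) := by simp [r]
    rw [h1, norm_smul, hstar, ht, norm_div, Complex.norm_real, Real.norm_of_nonneg (by positivity)]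
    field_simp
  set c₀ : ℝ := ‖s‖ / (‖WithLp.toLp 2 w‖ * ‖WithLp.toLp 2 y‖) with hc₀
  have hc₀pos : 0 < c₀ := div_pos (norm_pos_iff.2 hne) (mul_pos hwn hyn)
  have hφ : Tendsto (fun Δ => ‖r Δ‖ / ‖v Δ‖) (𝓝 0) (𝓝 c₀) := by
    have h1 : Tendsto (fun Δ => ‖r Δ‖ / ‖v Δ‖) (𝓝 0) (𝓝 (‖r 0‖ / ‖v 0‖)) :=
      (hrc.norm.tendsto 0).div (hvc.norm.tendsto 0) (by rw [hv0]; exact hyn.ne')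
    rwa [hr0, hv0, div_div, ← hc₀] at h1
  -- The perturbation has norm `Δ ‖r Δ‖ / ‖v Δ‖`, asymptotic to `c₀ Δ`. With slack `c > c₀`, the
  -- shift `Δ = ε / c` is admissible for small `ε`; finally `c` tends to `c₀`.
  have main : ∀ c, c₀ < c → ENNReal.ofReal (1 / c) ≤ eigCond A B lam := by
    intro c hc
    have hcpos : 0 < c := hc₀pos.trans hc
    refine le_iInf₂ fun δ hδ => ?_
    refine le_limsup_of_le (by isBoundedDefault) fun b hb => ?_
    have hlim : Tendsto (fun ε : ℝ => ε / c) (𝓝[>] 0) (𝓝 0) := by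
      have : Tendsto (fun ε : ℝ => ε / c) (𝓝 0) (𝓝 (0 / c)) := tendsto_id.div_const c
      rw [zero_div] at this
      exact this.mono_left nhdsWithin_le_nhds
    have e1 : ∀ᶠ Δ : ℝ in 𝓝 0, ‖r Δ‖ / ‖v Δ‖ < c := hφ.eventually (gt_mem_nhds hc)
    have e2 : ∀ᶠ Δ : ℝ in 𝓝 0, v Δ ≠ 0 := hvc.tendsto 0 |>.eventually_ne (by
      rw [hv0]; simpa using hy0)
    have e3 : ∀ᶠ Δ : ℝ in 𝓝 0, Δ < δ := gt_mem_nhds hδ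
    obtain ⟨ε, hε, h1, h2, h3, hε0⟩ := (hb.and ((hlim.eventually e1).and
      ((hlim.eventually e2).and ((hlim.eventually e3).and self_mem_nhdsWithin)))).exists
    replace hε0 : 0 < ε := hε0
    set Δ := ε / c with hΔ
    have hΔ0 : 0 < Δ := div_pos hε0 hcpos
    have hnΔ : ‖(Δ : ℂ)‖ = Δ := by rw [Complex.norm_real, Real.norm_of_nonneg hΔ0.le]
    have hvn : 0 < ‖v Δ‖ := norm_pos_iff.2 h2
    refine le_trans ?_ hε
    refine le_trans ?_ (le_iSup₂ (f := fun (D : ℂ) (_ : IsEigenvalueShift A B lam ε D ∧ ‖D‖ ≤ δ) =>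
      ENNReal.ofReal (‖D‖ / ε)) (Δ : ℂ) ⟨?_, by rw [hnΔ]; exact h3.le⟩)
    · rw [hnΔ, hΔ]
      refine le_of_eq (congrArg _ ?_)
      field_simp
    let L := (((Δ / ‖v Δ‖ ^ 2 : ℝ) : ℂ)) • InnerProductSpace.rankOne ℂ (r Δ) (v Δ)
    refine ⟨(Matrix.toEuclideanCLM (n := n) (𝕜 := ℂ)).symm L, 0, ?_, ?_, WithLp.ofLp (v Δ), ?_, ?_⟩
    · rw [spectralNorm, StarAlgEquiv.apply_symm_apply, norm_smul, InnerProductSpace.norm_rankOne,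
        Complex.norm_real, Real.norm_of_nonneg (by positivity)]
      have : Δ / ‖v Δ‖ ^ 2 * (‖r Δ‖ * ‖v Δ‖) = Δ * (‖r Δ‖ / ‖v Δ‖) := by field_simp
      rw [this]
      calc Δ * (‖r Δ‖ / ‖v Δ‖) ≤ Δ * c := mul_le_mul_of_nonneg_left h1.le hΔ0.le
        _ = ε := div_mul_cancel₀ _ hcpos.ne'
    · rw [spectralNorm, map_zero, norm_zero]
      exact hε0.le
    · simpa using h2
    · have hL : ((Matrix.toEuclideanCLM (n := n) (𝕜 := ℂ)).symm L).mulVec (WithLp.ofLp (v Δ)) =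
          (Δ : ℂ) • WithLp.ofLp (r Δ) := by
        rw [← Matrix.ofLp_toEuclideanCLM, StarAlgEquiv.apply_symm_apply, ← WithLp.ofLp_smul]
        congr 1
        simp only [L, smul_apply, InnerProductSpace.rankOne_apply,
          inner_self_eq_norm_sq_to_K, smul_smul]
        congr 1
        have : ((‖v Δ‖ : ℝ) : ℂ) ≠ 0 := by exact_mod_cast hvn.ne'
        simp only [Complex.coe_algebraMap, Complex.ofReal_div, Complex.ofReal_pow]
        field_simp
      have hsplit : (A + (Matrix.toEuclideanCLM (n := n) (𝕜 := ℂ)).symm L) -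
          (lam + (Δ : ℂ)) • (B + 0) = T - (Δ : ℂ) • B +
            (Matrix.toEuclideanCLM (n := n) (𝕜 := ℂ)).symm L := by
        rw [hT, add_zero, add_smul]
        abel
      rw [hsplit, Matrix.add_mulVec, hL, Matrix.sub_mulVec, Matrix.smul_mulVec]
      simp only [v, r, Matrix.mulVec_add, Matrix.mulVec_smul, hy, hz, smul_add, smul_sub]
      abel
  have hfin : ENNReal.ofReal (‖WithLp.toLp 2 w‖ * ‖WithLp.toLp 2 y‖ / ‖s‖) =
      ENNReal.ofReal (1 / c₀) := by
    rw [hc₀, one_div_div]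
  rw [hfin]
  have hlim : Tendsto (fun c : ℝ => ENNReal.ofReal (1 / c)) (𝓝[>] c₀)
      (𝓝 (ENNReal.ofReal (1 / c₀))) :=
    ENNReal.tendsto_ofReal ((tendsto_const_nhds.div tendsto_id hc₀pos.ne').mono_left
      nhdsWithin_le_nhds)
  exact le_of_tendsto hlim (eventually_nhdsWithin_of_forall main)

end Perturbation

/-! ### Genericity -/

/-- Evaluation of `a₀ + a₁ x₁ + ⋯ + a_d x_d` at `x` as a linear form in `a`. -/
def evalLinPoly {d : ℕ} (x : Fin d → ℂ) : (Fin (d + 1) → ℂ) →ₗ[ℂ] ℂ where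
  toFun a := eval x (linPoly a)
  map_add' a b := by
    simp [linPoly, add_mul, Finset.sum_add_distrib]
    ring
  map_smul' c a := by simp [linPoly, Finset.mul_sum, mul_add, mul_assoc]

lemma evalLinPoly_apply {d : ℕ} (x : Fin d → ℂ) (a : Fin (d + 1) → ℂ) :
    evalLinPoly x a = eval x (linPoly a) := rfl

lemma evalLinPoly_single_zero {d : ℕ} (x : Fin d → ℂ) : evalLinPoly x (Pi.single 0 1) = 1 := by
  simp [evalLinPoly_apply, linPoly]

lemma evalLinPoly_single_succ {d : ℕ} (x : Fin d → ℂ) (j : Fin d) :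
    evalLinPoly x (Pi.single j.succ 1) = x j := by
  rw [evalLinPoly_apply, linPoly, map_add, map_sum, Finset.sum_eq_single j]
  · simp
  · intro i _ hi
    simp [hi]
  · simp

lemma ae_apply_ne_zero {m : ℕ} (L : (Fin m → ℂ) →ₗ[ℂ] ℂ) (hL : L ≠ 0) :
    ∀ᵐ a : Fin m → ℂ, L a ≠ 0 := by
  have h := MeasureTheory.Measure.addHaar_submodule (MeasureTheory.volume : MeasureTheory.Measure
    (Fin m → ℂ)) ((LinearMap.ker L).restrictScalars ℝ) (by
      intro h
      refine hL (LinearMap.ext fun a => ?_)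
      have : a ∈ (LinearMap.ker L).restrictScalars ℝ := by rw [h]; trivial
      exact this)
  rw [MeasureTheory.ae_iff]
  convert h using 2
  ext a
  simp

lemma ae_isGenericPair {d : ℕ} {p : Fin d → Poly d} (hfin : {x | IsSystemRoot p x}.Finite) :
    ∀ᵐ ab : (Fin (d + 1) → ℂ) × (Fin (d + 1) → ℂ) ∂MeasureTheory.volume,
      IsGenericPair p ab.1 ab.2 := by
  have hne : ∀ x : Fin d → ℂ, ∀ᵐ a : Fin (d + 1) → ℂ, eval x (linPoly a) ≠ 0 := fun x =>
    ae_apply_ne_zero (evalLinPoly x) fun h => by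
      have := evalLinPoly_single_zero x
      rw [h] at this
      exact zero_ne_one this
  have hcont : ∀ x : Fin d → ℂ, Continuous fun a : Fin (d + 1) → ℂ => eval x (linPoly a) :=
    fun x => (evalLinPoly x).continuous_of_finiteDimensional
  have hpair : ∀ x y : Fin d → ℂ, x ≠ y → ∀ᵐ ab : (Fin (d + 1) → ℂ) × (Fin (d + 1) → ℂ),
      eval x (linPoly ab.1) * eval y (linPoly ab.2) ≠
        eval y (linPoly ab.1) * eval x (linPoly ab.2) := by
    intro x y hxy
    rw [MeasureTheory.Measure.volume_eq_prod, MeasureTheory.Measure.ae_prod_iff_ae_ae]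
    · filter_upwards [hne x] with a ha
      -- For fixed `a` the bad `b` form the kernel of this linear form. Were it zero, its value at
      -- the constant coefficient would give equal values of `linPoly a` at `x` and `y`, and the
      -- other coefficients would force `x = y`.
      have hL : eval x (linPoly a) • evalLinPoly y - eval y (linPoly a) • evalLinPoly x ≠ 0 := by
        intro h
        have h0 := LinearMap.congr_fun h (Pi.single 0 1)
        simp only [LinearMap.sub_apply, LinearMap.smul_apply, evalLinPoly_single_zero, smul_eq_mul,
          mul_one, LinearMap.zero_apply, sub_eq_zero] at h0
        refine hxy (funext fun j => ?_)
        have hj := LinearMap.congr_fun h (Pi.single j.succ 1)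
        simp only [LinearMap.sub_apply, LinearMap.smul_apply, evalLinPoly_single_succ, smul_eq_mul,
          LinearMap.zero_apply, ← h0, sub_eq_zero] at hj
        exact (mul_left_cancel₀ ha hj).symm
      exact (ae_apply_ne_zero _ hL).mono fun b hb => sub_ne_zero.1 hb
    · refine IsOpen.measurableSet (isOpen_ne_fun ?_ ?_)
      · exact ((hcont x).comp continuous_fst).mul ((hcont y).comp continuous_snd)
      · exact ((hcont y).comp continuous_fst).mul ((hcont x).comp continuous_snd)
  have hc := hfin.countable
  have h1 : ∀ᵐ ab : (Fin (d + 1) → ℂ) × (Fin (d + 1) → ℂ), ∀ x ∈ {x | IsSystemRoot p x},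
      eval x (linPoly ab.2) ≠ 0 :=
    (MeasureTheory.ae_ball_iff hc).2 fun x _ =>
      MeasureTheory.Measure.quasiMeasurePreserving_snd.ae (hne x)
  have h2 : ∀ᵐ ab : (Fin (d + 1) → ℂ) × (Fin (d + 1) → ℂ), ∀ x ∈ {x | IsSystemRoot p x},
      ∀ y ∈ {x | IsSystemRoot p x}, x ≠ y → eval x (linPoly ab.1) * eval y (linPoly ab.2) ≠
        eval y (linPoly ab.1) * eval x (linPoly ab.2) :=
    (MeasureTheory.ae_ball_iff hc).2 fun x _ => (MeasureTheory.ae_ball_iff hc).2 fun y _ => by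
      by_cases hxy : x = y
      · exact Eventually.of_forall fun _ h => absurd hxy h
      · exact (hpair x y hxy).mono fun _ h _ => h
  filter_upwards [h1, h2] with ab h h'
  exact ⟨h, fun x y hx hy hxy => h' x hx y hy hxy⟩

/-! ### Rows of the pencil as polynomials -/

section Rows
variable {d : ℕ} {p : Fin d → Poly d}

/-- The polynomial of a row belonging to the system, and zero for the other rows. -/
def sysPoly (p : Fin d → Poly d) : SysRow p ⊕ LinRow p → Poly d :=
  Sum.elim (sysRowPoly p) 0

/-- The monomial of a row belonging to the linear form, and zero for the other rows. -/
def linMonomial (p : Fin d → Poly d) : SysRow p ⊕ LinRow p → Poly d :=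
  Sum.elim 0 fun m => monomial m.1 1

lemma matA_apply (α : Fin (d + 1) → ℂ) (sel : Col p ↪ SysRow p ⊕ LinRow p) (c c' : Col p) :
    matA p α sel c c' = coeff c'.1 (sysPoly p (sel c) + linMonomial p (sel c) * linPoly α) := by
  rw [matA, Matrix.submatrix_apply, id, macaulayMatrix, Matrix.of_apply]
  rcases sel c with s | m <;> simp [sysPoly, linMonomial]

lemma matB_apply (β : Fin (d + 1) → ℂ) (sel : Col p ↪ SysRow p ⊕ LinRow p) (c c' : Col p) :
    matB p β sel c c' = coeff c'.1 (linMonomial p (sel c) * linPoly β) := by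
  rw [matB, Matrix.submatrix_apply, id, macaulayMatrixLin, Matrix.of_apply]
  rcases sel c with s | m <;> simp [linMonomial]

/-- The linear form `h(μ) = h_α - μ h_β`. -/
def pencilPoly (α β : Fin (d + 1) → ℂ) (μ : ℂ) : Poly d := linPoly α - C μ * linPoly β

lemma pencil_apply (α β : Fin (d + 1) → ℂ) (μ : ℂ) (sel : Col p ↪ SysRow p ⊕ LinRow p)
    (c c' : Col p) : (matA p α sel - μ • matB p β sel) c c' =
      coeff c'.1 (sysPoly p (sel c) + linMonomial p (sel c) * pencilPoly α β μ) := by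
  rw [Matrix.sub_apply, Matrix.smul_apply, matA_apply, matB_apply, smul_eq_mul, ← coeff_C_mul,
    ← coeff_sub, pencilPoly]
  congr 1
  ring

lemma totalDegree_linPoly_le (a : Fin (d + 1) → ℂ) : (linPoly a).totalDegree ≤ 1 := by
  refine (totalDegree_add _ _).trans (max_le (by simp) (totalDegree_finsetSum_le fun i _ => ?_))
  exact (isHomogeneous_C_mul_X _ _).totalDegree_le

lemma totalDegree_pencilPoly_le (α β : Fin (d + 1) → ℂ) (μ : ℂ) :
    (pencilPoly α β μ).totalDegree ≤ 1 := by
  refine (totalDegree_sub _ _).trans (max_le (totalDegree_linPoly_le α) ?_)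
  refine (totalDegree_mul _ _).trans ?_
  rw [totalDegree_C, zero_add]
  exact totalDegree_linPoly_le β

lemma eval_pencilPoly (α β : Fin (d + 1) → ℂ) (μ : ℂ) (x : Fin d → ℂ) :
    eval x (pencilPoly α β μ) = eval x (linPoly α) - μ * eval x (linPoly β) := by
  simp [pencilPoly]

lemma totalDegree_linMonomial_mul_le (r : SysRow p ⊕ LinRow p) {h : Poly d}
    (hh : h.totalDegree ≤ 1) : (linMonomial p r * h).totalDegree ≤ rho p := by
  rcases r with s | m
  · simp [linMonomial]
  · refine (totalDegree_mul _ _).trans (le_trans (add_le_add ?_ hh) m.2)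
    exact totalDegree_monomial_le _ _

lemma totalDegree_sysPoly_le (r : SysRow p ⊕ LinRow p) : (sysPoly p r).totalDegree ≤ rho p := by
  rcases r with s | m
  · refine (totalDegree_mul _ _).trans (le_trans (add_le_add_left ?_ _) s.2)
    exact totalDegree_monomial_le _ _
  · simp [sysPoly]

lemma totalDegree_row_le (r : SysRow p ⊕ LinRow p) {h : Poly d} (hh : h.totalDegree ≤ 1) :
    (sysPoly p r + linMonomial p r * h).totalDegree ≤ rho p :=
  (totalDegree_add _ _).trans (max_le (totalDegree_sysPoly_le r)
    (totalDegree_linMonomial_mul_le r hh))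

lemma sum_coeff_mul_colLabels {f : Poly d} (hf : f.totalDegree ≤ rho p) (x : Fin d → ℂ) :
    ∑ c : Col p, coeff c.1 f * ∏ i, x i ^ c.1 i = eval x f := by
  classical
  rw [eval_eq']
  have hmem : ∀ m ∈ f.support, m.degree ≤ rho p := fun m hm => (le_totalDegree hm).trans hf
  rw [← Finset.sum_filter_of_ne (p := fun c : Col p => c.1 ∈ f.support)]
  · refine Finset.sum_bij (fun c _ => c.1) (fun c hc => (Finset.mem_filter.1 hc).2)
      (fun c _ c' _ h => Subtype.ext h) (fun m hm => ⟨⟨m, hmem m hm⟩, by simpa using hm, rfl⟩)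
      fun c _ => rfl
  · intro c _ hc
    exact mem_support_iff.2 (left_ne_zero_of_mul hc)

lemma eq_zero_of_forall_coeff_eq_zero {f : Poly d} (hf : f.totalDegree ≤ rho p)
    (h : ∀ c : Col p, coeff c.1 f = 0) : f = 0 := by
  ext m
  rw [coeff_zero]
  by_contra hm
  exact hm (h ⟨m, (le_totalDegree (mem_support_iff.2 hm)).trans hf⟩)

variable (sel : Col p ↪ SysRow p ⊕ LinRow p)

/-- The part in the span of the system rows of a combination of the rows of the pencil. -/
def sysPart : (Col p → ℂ) →ₗ[ℂ] Poly d := Fintype.linearCombination ℂ fun c => sysPoly p (sel c)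

/-- The factor of the linear form in a combination of the rows of the pencil. -/
def linPart : (Col p → ℂ) →ₗ[ℂ] Poly d :=
  Fintype.linearCombination ℂ fun c => linMonomial p (sel c)

lemma sysPart_add_linPart_mul (u : Col p → ℂ) (h : Poly d) :
    sysPart sel u + linPart sel u * h =
      ∑ c, u c • (sysPoly p (sel c) + linMonomial p (sel c) * h) := by
  simp only [sysPart, linPart, Fintype.linearCombination_apply, Finset.sum_mul, smul_add,
    Finset.sum_add_distrib, smul_mul_assoc]

lemma totalDegree_sysPart_add_linPart_mul_le (u : Col p → ℂ) {h : Poly d}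
    (hh : h.totalDegree ≤ 1) : (sysPart sel u + linPart sel u * h).totalDegree ≤ rho p := by
  rw [sysPart_add_linPart_mul]
  exact totalDegree_finsetSum_le fun c _ =>
    (totalDegree_smul_le _ _).trans (totalDegree_row_le _ hh)

lemma totalDegree_linPart_mul_le (u : Col p → ℂ) {h : Poly d}
    (hh : h.totalDegree ≤ 1) : (linPart sel u * h).totalDegree ≤ rho p := by
  rw [linPart, Fintype.linearCombination_apply, Finset.sum_mul]
  refine totalDegree_finsetSum_le fun c _ => ?_
  rw [smul_mul_assoc]
  exact (totalDegree_smul_le _ _).trans (totalDegree_linMonomial_mul_le _ hh)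

lemma vecMul_pencil_apply (α β : Fin (d + 1) → ℂ) (μ : ℂ) (u : Col p → ℂ) (c : Col p) :
    Matrix.vecMul u (matA p α sel - μ • matB p β sel) c =
      coeff c.1 (sysPart sel u + linPart sel u * pencilPoly α β μ) := by
  rw [sysPart_add_linPart_mul, coeff_sum, Matrix.vecMul, dotProduct]
  exact Finset.sum_congr rfl fun c' _ => by rw [pencil_apply, coeff_smul, smul_eq_mul]

/-- All rows have degree at most `ρ`, so the columns record every coefficient. -/
lemma vecMul_pencil_eq_zero_iff (α β : Fin (d + 1) → ℂ) (μ : ℂ) (u : Col p → ℂ) :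
    Matrix.vecMul u (matA p α sel - μ • matB p β sel) = 0 ↔
      sysPart sel u + linPart sel u * pencilPoly α β μ = 0 := by
  constructor
  · intro h
    refine eq_zero_of_forall_coeff_eq_zero (p := p)
      (totalDegree_sysPart_add_linPart_mul_le sel u (totalDegree_pencilPoly_le α β μ)) fun c => ?_
    rw [← vecMul_pencil_apply, h, Pi.zero_apply]
  · intro h
    funext c
    rw [vecMul_pencil_apply, h, coeff_zero, Pi.zero_apply]

lemma sysPart_mem (u : Col p → ℂ) : sysPart sel u ∈ systemIdeal p := by
  rw [sysPart, Fintype.linearCombination_apply]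
  refine Submodule.sum_mem _ fun c _ => Submodule.smul_of_tower_mem _ _ ?_
  rcases sel c with s | m
  · exact Ideal.mul_mem_left _ _ (Ideal.subset_span ⟨_, rfl⟩)
  · exact zero_mem _

/-- The position in the pencil of a retained row of the linear form. -/
def position (m : RetainedLinRow sel) : Col p := m.2.choose

lemma sel_position (m : RetainedLinRow sel) : sel (position sel m) = Sum.inr m.1 :=
  m.2.choose_spec

lemma position_injective : Function.Injective (position sel) := fun m m' h => by
  have := sel_position sel m
  rw [h, sel_position sel m'] at this
  exact Subtype.ext (Sum.inr_injective this).symm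

lemma exists_position_eq {c : Col p} {m : LinRow p} (h : sel c = Sum.inr m) :
    ∃ m', position sel m' = c := by
  refine ⟨⟨m, c, h⟩, sel.injective ?_⟩
  rw [sel_position, h]

instance finite_retainedLinRow : Finite (RetainedLinRow sel) :=
  Finite.of_injective _ (position_injective sel)

lemma linPart_eq [Fintype (RetainedLinRow sel)] (u : Col p → ℂ) :
    linPart sel u = ∑ m : RetainedLinRow sel, u (position sel m) • monomial m.1.1 (1 : ℂ) := by
  rw [linPart, Fintype.linearCombination_apply]
  refine (Fintype.sum_of_injective (position sel) (position_injective sel) _ _ (fun c hc => ?_)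
    fun m => ?_).symm
  · rcases h : sel c with s | m
    · simp [linMonomial]
    · exact absurd (exists_position_eq sel h) hc
  · rw [sel_position]
    rfl

lemma sysPart_extend (k : RetainedLinRow sel → ℂ) :
    sysPart sel (Function.extend (position sel) k 0) = 0 := by
  rw [sysPart, Fintype.linearCombination_apply]
  refine Finset.sum_eq_zero fun c _ => ?_
  rcases h : sel c with s | m
  · rw [Function.extend_apply', Pi.zero_apply, zero_smul]
    rintro ⟨m, rfl⟩
    rw [sel_position] at h
    cases h
  · simp [sysPoly]

variable {sel}

/-- The omitted system rows are spanned by the retained ones. Entries at `h`-rows do not affect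
`sysPart`, so they can be set to zero. -/
lemma NoRootsAtInfinity.exists_sysPart_eq (hinf : NoRootsAtInfinity p) {α β : Fin (d + 1) → ℂ}
    (hsel : IsMacaulayEigenproblem p α β sel) {f : Poly d} (hf : f ∈ systemIdeal p)
    (hd : f.totalDegree ≤ rho p) :
    ∃ u, sysPart sel u = f ∧ ∀ m, u (position sel m) = 0 := by
  classical
  have h1 : f ∈ LinearMap.range (sysPart sel) := by
    have hle : Submodule.span ℂ (Set.range (sysRowPoly p)) ≤ LinearMap.range (sysPart sel) := by
      have hle' : Submodule.span ℂ (sysRowPoly p '' {s : SysRow p | Sum.inl s ∈ Set.range sel}) ≤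
          LinearMap.range (sysPart sel) := by
        rw [Submodule.span_le]
        rintro _ ⟨s, ⟨c, hc⟩, rfl⟩
        refine ⟨Pi.single c 1, ?_⟩
        rw [sysPart, Fintype.linearCombination_apply_single, hc, one_smul]
        rfl
      rw [Submodule.span_le]
      rintro _ ⟨r, rfl⟩
      exact hle' (hsel.system_rows r)
    exact hle (hinf.mem_span_sysRowPoly hf hd)
  obtain ⟨u, rfl⟩ := h1
  refine ⟨u - Function.extend (position sel) (fun m => u (position sel m)) 0, ?_, fun m => ?_⟩
  · rw [map_sub, sysPart_extend, sub_zero]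
  · rw [Pi.sub_apply, (position_injective sel).extend_apply, sub_self]

section Regular
variable {α β : Fin (d + 1) → ℂ} {μ : ℂ}

lemma eq_zero_of_det_ne_zero (hμ : (matA p α sel - μ • matB p β sel).det ≠ 0) {u : Col p → ℂ}
    (hu : sysPart sel u + linPart sel u * pencilPoly α β μ = 0) : u = 0 :=
  Matrix.eq_zero_of_vecMul_eq_zero hμ ((vecMul_pencil_eq_zero_iff sel α β μ u).2 hu)

lemma exists_eq_of_det_ne_zero (hμ : (matA p α sel - μ • matB p β sel).det ≠ 0) {f : Poly d}
    (hf : f.totalDegree ≤ rho p) :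
    ∃ u, sysPart sel u + linPart sel u * pencilPoly α β μ = f := by
  refine ⟨Matrix.vecMul (fun c => coeff c.1 f) (matA p α sel - μ • matB p β sel)⁻¹, ?_⟩
  refine sub_eq_zero.1 (eq_zero_of_forall_coeff_eq_zero (p := p) ?_ fun c => ?_)
  · exact (totalDegree_sub _ _).trans (max_le
      (totalDegree_sysPart_add_linPart_mul_le sel _ (totalDegree_pencilPoly_le α β μ)) hf)
  · rw [coeff_sub, ← vecMul_pencil_apply, Matrix.vecMul_vecMul,
      Matrix.nonsing_inv_mul _ (isUnit_iff_ne_zero.2 hμ), Matrix.vecMul_one, sub_self]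

end Regular

end Rows

/-! ### The basis of the quotient ring -/

section Basis
variable {d : ℕ} {p : Fin d → Poly d} {α β : Fin (d + 1) → ℂ}
  {sel : Col p ↪ SysRow p ⊕ LinRow p}

/-- The class modulo the ideal of the monomial of a retained row of the linear form. -/
def retainedClass (sel : Col p ↪ SysRow p ⊕ LinRow p) (m : RetainedLinRow sel) :
    Poly d ⧸ systemIdeal p :=
  Ideal.Quotient.mk (systemIdeal p) (monomial m.1.1 1)

lemma mk_smul (c : ℂ) (f : Poly d) : Ideal.Quotient.mk (systemIdeal p) (c • f) =
    c • Ideal.Quotient.mk (systemIdeal p) f := rfl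

lemma mk_linPart [Fintype (RetainedLinRow sel)] (u : Col p → ℂ) :
    Ideal.Quotient.mk (systemIdeal p) (linPart sel u) =
      ∑ m, u (position sel m) • retainedClass sel m := by
  rw [linPart_eq, map_sum]
  exact Finset.sum_congr rfl fun m _ => mk_smul _ _

/-- If a combination of the retained monomials lies in the ideal, its product with `h(μ)` is a
combination of system rows. This is a dependence among the rows of the pencil at `μ`, excluded by
regularity. -/
lemma IsMacaulayEigenproblem.linearIndependent (hsel : IsMacaulayEigenproblem p α β sel)
    (hinf : NoRootsAtInfinity p) : LinearIndependent ℂ (retainedClass sel) := by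
  have := Fintype.ofFinite (RetainedLinRow sel)
  obtain ⟨μ, hμ⟩ := hsel.regular
  refine Fintype.linearIndependent_iff.2 fun k hk m => ?_
  set v := Function.extend (position sel) k 0 with hv
  have hvm : ∀ m, v (position sel m) = k m := fun m => (position_injective sel).extend_apply _ _ _
  have hmem : linPart sel v ∈ systemIdeal p := by
    rw [← Ideal.Quotient.eq_zero_iff_mem, mk_linPart, ← hk]
    simp only [hvm]
  obtain ⟨u, hu, hu0⟩ := hinf.exists_sysPart_eq hsel
    (Ideal.mul_mem_right (pencilPoly α β μ) _ hmem)
    (totalDegree_linPart_mul_le sel v (totalDegree_pencilPoly_le α β μ))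
  have hlin : linPart sel u = 0 := by
    rw [linPart_eq]
    simp [hu0]
  have h0 : v - u = 0 := eq_zero_of_det_ne_zero hμ (by
    rw [map_sub, map_sub, hu, hlin, sysPart_extend]
    ring)
  rw [← hvm m, sub_eq_zero.1 h0, hu0]

lemma IsMacaulayEigenproblem.top_le_span (hsel : IsMacaulayEigenproblem p α β sel)
    (hfin : {x | IsSystemRoot p x}.Finite)
    (hsimple : ∀ x, IsSystemRoot p x → IsUnit (jacobian p x)) :
    ⊤ ≤ Submodule.span ℂ (Set.range (retainedClass sel)) := by
  have := Fintype.ofFinite (RetainedLinRow sel)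
  obtain ⟨μ, hμ⟩ := hsel.regular
  set H := Ideal.Quotient.mk (systemIdeal p) (pencilPoly α β μ)
  have key : ∀ f, ∃ s ∈ Submodule.span ℂ (Set.range (retainedClass sel)), f = s * H := by
    intro f
    obtain ⟨F, rfl⟩ := Ideal.Quotient.mk_surjective f
    obtain ⟨G, hG, hFG⟩ := exists_totalDegree_le_rho hfin hsimple F
    obtain ⟨u, rfl⟩ := exists_eq_of_det_ne_zero hμ hG
    refine ⟨Ideal.Quotient.mk _ (linPart sel u), ?_, ?_⟩
    · rw [mk_linPart]
      exact Submodule.sum_mem _ fun m _ => Submodule.smul_mem _ _ (Submodule.subset_span ⟨m, rfl⟩)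
    · rw [Ideal.Quotient.eq.2 hFG, map_add, Ideal.Quotient.eq_zero_iff_mem.2 (sysPart_mem sel u),
        zero_add, map_mul]
  -- The case `f = 1` shows that `H` is invertible, so it can be cancelled from `f * H = s * H`.
  obtain ⟨s₀, -, hs₀⟩ := key 1
  intro f _
  obtain ⟨s, hs, hfs⟩ := key (f * H)
  have : f = s := by
    calc f = s₀ * (f * H) := by rw [mul_left_comm, ← hs₀, mul_one]
      _ = s := by rw [hfs, mul_left_comm, ← hs₀, mul_one]
  rwa [this]

end Basis

/-! ### The eigenvectors belonging to a root -/

section Eigenvectors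
variable {d : ℕ} {p : Fin d → Poly d} {α β : Fin (d + 1) → ℂ}
  {sel : Col p ↪ SysRow p ⊕ LinRow p} {x : Fin d → ℂ} {lam : ℂ}

lemma pencil_mulVec_colLabels (hx : IsSystemRoot p x)
    (hlam : eval x (linPoly α) - lam * eval x (linPoly β) = 0) :
    (matA p α sel - lam • matB p β sel).mulVec (WithLp.ofLp (colLabels p x)) = 0 := by
  funext c
  rw [Matrix.mulVec, dotProduct, Pi.zero_apply]
  simp only [pencil_apply, colLabels]
  rw [sum_coeff_mul_colLabels (totalDegree_row_le _ (totalDegree_pencilPoly_le α β lam)), map_add,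
    map_mul, eval_pencilPoly, hlam, mul_zero, add_zero]
  rcases sel c with s | m
  · exact eval_eq_zero_of_mem hx (Ideal.mul_mem_left _ _ (Ideal.subset_span ⟨_, rfl⟩))
  · exact map_zero _

lemma dotProduct_matB_mulVec_colLabels (w : Col p → ℂ) :
    w ⬝ᵥ (matB p β sel).mulVec (WithLp.ofLp (colLabels p x)) =
      eval x (linPart sel w) * eval x (linPoly β) := by
  have h1 : ∀ c, (matB p β sel).mulVec (WithLp.ofLp (colLabels p x)) c =
      eval x (linMonomial p (sel c)) * eval x (linPoly β) := by
    intro c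
    rw [Matrix.mulVec, dotProduct]
    simp only [matB_apply, colLabels]
    rw [sum_coeff_mul_colLabels (totalDegree_linMonomial_mul_le _ (totalDegree_linPoly_le β)),
      map_mul]
  rw [linPart, Fintype.linearCombination_apply, map_sum, Finset.sum_mul, dotProduct]
  refine Finset.sum_congr rfl fun c _ => ?_
  rw [h1, smul_eval]
  ring

/-- The left eigenspace belonging to a root is at most one-dimensional. -/
lemma IsMacaulayEigenproblem.exists_eq_smul (hsel : IsMacaulayEigenproblem p α β sel)
    (hsimple : ∀ x, IsSystemRoot p x → IsUnit (jacobian p x)) (hinf : NoRootsAtInfinity p)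
    (hgen : IsGenericPair p α β) (hx : IsSystemRoot p x)
    (hlam : eval x (linPoly α) - lam * eval x (linPoly β) = 0) {w : Col p → ℂ}
    (hw : sysPart sel w + linPart sel w * pencilPoly α β lam = 0)
    (hwx : eval x (linPart sel w) ≠ 0) {u : Col p → ℂ}
    (hu : sysPart sel u + linPart sel u * pencilPoly α β lam = 0) : ∃ c : ℂ, u = c • w := by
  have := Fintype.ofFinite (RetainedLinRow sel)
  -- By genericity `h(λ)` is nonzero at every other root, so the polynomial factor of a left null
  -- vector vanishes there.
  have hvan : ∀ u : Col p → ℂ, sysPart sel u + linPart sel u * pencilPoly α β lam = 0 →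
      ∀ y, IsSystemRoot p y → y ≠ x → eval y (linPart sel u) = 0 := by
    intro u hu y hy hyx
    have h1 := congrArg (eval y) hu
    rw [map_add, eval_eq_zero_of_mem hy (sysPart_mem sel u), zero_add, map_mul, map_zero] at h1
    refine (mul_eq_zero.1 h1).resolve_right fun h2 => ?_
    rw [eval_pencilPoly] at h2
    refine hgen.2 y x hy hx hyx ?_
    rw [sub_eq_zero.1 h2, sub_eq_zero.1 hlam]
    ring
  set c := eval x (linPart sel u) / eval x (linPart sel w) with hc
  refine ⟨c, sub_eq_zero.1 ?_⟩
  set v := u - c • w with hv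
  have hvs : sysPart sel v + linPart sel v * pencilPoly α β lam = 0 := by
    rw [hv, map_sub, map_sub, map_smul, map_smul]
    have : sysPart sel u - c • sysPart sel w + (linPart sel u - c • linPart sel w) *
        pencilPoly α β lam = (sysPart sel u + linPart sel u * pencilPoly α β lam) -
          c • (sysPart sel w + linPart sel w * pencilPoly α β lam) := by
      simp only [smul_eq_C_mul]
      ring
    rw [this, hu, hw, smul_zero, sub_zero]
  have hmem : linPart sel v ∈ systemIdeal p := by
    refine mem_systemIdeal_of_forall_eval_eq_zero hsimple fun y hy => ?_
    by_cases hyx : y = x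
    · rw [hyx, hv, map_sub, map_smul, map_sub, smul_eval, hc, div_mul_cancel₀ _ hwx, sub_self]
    · exact hvan v hvs y hy hyx
  -- The factor of `v` now vanishes at all roots, hence lies in the ideal, and independence of the
  -- retained classes kills the `h`-entries. What remains is a dependence among system rows alone,
  -- excluded by regularity at any `μ`.
  have hpos : ∀ m, v (position sel m) = 0 := by
    rw [← Ideal.Quotient.eq_zero_iff_mem, mk_linPart] at hmem
    exact Fintype.linearIndependent_iff.1 (hsel.linearIndependent hinf) _ hmem
  have hlin : linPart sel v = 0 := by
    rw [linPart_eq]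
    simp [hpos]
  rw [hlin, zero_mul, add_zero] at hvs
  obtain ⟨μ, hμ⟩ := hsel.regular
  exact eq_zero_of_det_ne_zero hμ (by rw [hvs, hlin, zero_mul, zero_add])

lemma coordNorm_le [Fintype (RetainedLinRow sel)] {W : Type*} [AddCommGroup W] [Module ℂ W]
    (b : Module.Basis (RetainedLinRow sel) ℂ W) (f : W) (w : Col p → ℂ)
    (hw : ∀ m, w (position sel m) = b.repr f m) : coordNorm b f ≤ ‖WithLp.toLp 2 w‖ := by
  rw [coordNorm, EuclideanSpace.norm_eq]
  refine Real.sqrt_le_sqrt ?_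
  rw [Finsupp.sum_fintype _ _ (by simp)]
  have : ∑ m, ‖b.repr f m‖ ^ 2 =
      ∑ c ∈ Finset.univ.map ⟨position sel, position_injective sel⟩, ‖w c‖ ^ 2 := by
    rw [Finset.sum_map]
    exact Finset.sum_congr rfl fun m _ => by rw [← hw m]; rfl
  rw [this]
  exact Finset.sum_le_univ_sum_of_nonneg fun c => by positivity

/-- The left eigenvector is `w = v - u`: `v` carries the coordinates of `det Q` at the `h`-rows, and
`u` expresses the resulting multiple of `h(λ)` by system rows. The system entries are ignored when
bounding `‖w‖` from below. -/
theorem IsMacaulayEigenproblem.le_eigCond (hsel : IsMacaulayEigenproblem p α β sel)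
    (hsimple : ∀ x, IsSystemRoot p x → IsUnit (jacobian p x)) (hinf : NoRootsAtInfinity p)
    (hgen : IsGenericPair p α β)
    (b : Module.Basis (RetainedLinRow sel) ℂ (Poly d ⧸ systemIdeal p))
    (hb : ∀ m, b m = retainedClass sel m) (hx : IsSystemRoot p x)
    {Q : Matrix (Fin d) (Fin d) (Poly d)} (hQ : ∀ i, p i = ∑ j, Q i j * (X j - C (x j)))
    (hlam : eval x (linPoly α) - lam * eval x (linPoly β) = 0) :
    ENNReal.ofReal (coordNorm b (Ideal.Quotient.mk (systemIdeal p) Q.det) * ‖colLabels p x‖ /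
        ‖(jacobian p x).det * eval x (linPoly β)‖) ≤
      eigCond (matA p α sel) (matB p β sel) lam := by
  have := Fintype.ofFinite (RetainedLinRow sel)
  set k := b.repr (Ideal.Quotient.mk (systemIdeal p) Q.det) with hk
  set v := Function.extend (position sel) k 0 with hv
  have hvm : ∀ m, v (position sel m) = k m := fun m => (position_injective sel).extend_apply _ _ _
  have hG : linPart sel v - Q.det ∈ systemIdeal p := by
    rw [← Ideal.Quotient.eq, mk_linPart, ← b.sum_repr (Ideal.Quotient.mk (systemIdeal p) Q.det)]
    exact Finset.sum_congr rfl fun m _ => by rw [hvm, hb]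
  have hGh : linPart sel v * pencilPoly α β lam ∈ systemIdeal p := by
    have h1 := Ideal.mul_mem_right (pencilPoly α β lam) _ hG
    have h2 := det_mul_mem hQ (f := pencilPoly α β lam) (by rw [eval_pencilPoly, hlam])
    rw [sub_mul] at h1
    simpa using add_mem h1 h2
  obtain ⟨u, hu, hu0⟩ := hinf.exists_sysPart_eq hsel hGh
    (totalDegree_linPart_mul_le sel v (totalDegree_pencilPoly_le α β lam))
  have hlin : linPart sel u = 0 := by
    rw [linPart_eq]
    simp [hu0]
  set w := v - u with hw
  have hwlin : linPart sel w = linPart sel v := by rw [hw, map_sub, hlin, sub_zero]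
  have hws : sysPart sel w + linPart sel w * pencilPoly α β lam = 0 := by
    rw [hwlin, hw, map_sub, hu, sysPart_extend]
    ring
  have hwx : eval x (linPart sel w) = (jacobian p x).det := by
    have := eval_eq_zero_of_mem hx hG
    rw [map_sub, sub_eq_zero] at this
    rw [hwlin, this, eval_det_eq_det_jacobian hQ]
  have hJ : (jacobian p x).det ≠ 0 := det_jacobian_ne_zero (hsimple x hx)
  have hdot : w ⬝ᵥ (matB p β sel).mulVec (WithLp.ofLp (colLabels p x)) =
      (jacobian p x).det * eval x (linPoly β) := by
    rw [dotProduct_matB_mulVec_colLabels, hwx]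
  have hmain := Macaulay.le_eigCond (matA p α sel) (matB p β sel) lam
    (WithLp.ofLp (colLabels p x)) w (pencil_mulVec_colLabels hx hlam)
    (fun u hu => hsel.exists_eq_smul hsimple hinf hgen hx hlam hws (by rwa [hwx])
      ((vecMul_pencil_eq_zero_iff sel α β lam u).1 hu))
    (by rw [hdot]; exact mul_ne_zero hJ (hgen.1 x hx))
  rw [hdot] at hmain
  refine le_trans (ENNReal.ofReal_le_ofReal ?_) hmain
  have hnorm : coordNorm b (Ideal.Quotient.mk (systemIdeal p) Q.det) ≤ ‖WithLp.toLp 2 w‖ :=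
    coordNorm_le b _ w fun m => by rw [hw, Pi.sub_apply, hu0, sub_zero, hvm]
  exact div_le_div_of_nonneg_right (mul_le_mul_of_nonneg_right hnorm (norm_nonneg _))
    (norm_nonneg _)

end Eigenvectors

end Macaulay

end

/-! ### The main theorem -/

theorem mainTheorem4 (d : ℕ) (hd : 2 ≤ d) (p : Fin d → Macaulay.Poly d)
    (hfin : {x | Macaulay.IsSystemRoot p x}.Finite)
    (hsimple : ∀ x, Macaulay.IsSystemRoot p x → IsUnit (Macaulay.jacobian p x))
    (hinf : Macaulay.NoRootsAtInfinity p) :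
    (∀ᵐ ab : (Fin (d + 1) → ℂ) × (Fin (d + 1) → ℂ) ∂MeasureTheory.volume,
      Macaulay.IsGenericPair p ab.1 ab.2) ∧
    ∀ α β : Fin (d + 1) → ℂ, Macaulay.IsGenericPair p α β →
    ∀ sel : Macaulay.Col p ↪ Macaulay.SysRow p ⊕ Macaulay.LinRow p,
    Macaulay.IsMacaulayEigenproblem p α β sel →
    ∃ b : Module.Basis (Macaulay.RetainedLinRow sel) ℂ
        (Macaulay.Poly d ⧸ Macaulay.systemIdeal p),
      (∀ m, b m = Ideal.Quotient.mk (Macaulay.systemIdeal p) (monomial m.1.1 1)) ∧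
      ∀ x : Fin d → ℂ, Macaulay.IsSystemRoot p x →
      ∀ Q : Matrix (Fin d) (Fin d) (Macaulay.Poly d),
      (∀ i, p i = ∑ j, Q i j * (X j - C (x j))) →
      ∀ lam : ℂ,
      eval x (Macaulay.linPoly α) - lam * eval x (Macaulay.linPoly β) = 0 →
      ENNReal.ofReal
        (Macaulay.coordNorm b (Ideal.Quotient.mk (Macaulay.systemIdeal p) Q.det) *
            ‖Macaulay.colLabels p x‖ /
          ‖(Macaulay.jacobian p x).det * eval x (Macaulay.linPoly β)‖) ≤
        Macaulay.eigCond (Macaulay.matA p α sel) (Macaulay.matB p β sel) lam := by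
  refine ⟨Macaulay.ae_isGenericPair hfin, fun α β hgen sel hsel => ?_⟩
  have hb : ∀ m, Module.Basis.mk (hsel.linearIndependent hinf) (hsel.top_le_span hfin hsimple) m =
      Macaulay.retainedClass sel m := fun m => Module.Basis.mk_apply _ _ m
  exact ⟨Module.Basis.mk (hsel.linearIndependent hinf) (hsel.top_le_span hfin hsimple), hb,
    fun x hx Q hQ lam hlam => hsel.le_eigCond hsimple hinf hgen _ hb hx hQ hlam⟩
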